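/- Let $\gamma\in\mathbb{R}\setminus\{0\}$, and let $\lambda\in\mathbb{R}$ satisfy $\lambda>0$ if $\gamma<0$ and $\lambda>\gamma^2/4$ if $\gamma>0$. Let $-\Delta_\gamma$ be the operator on $L^2(\mathbb{R})=L^2(\mathbb{R};\mathbb{C})$ with domain $$\mathcal{D}(-\Delta_\gamma)=\{f\in H^1(\mathbb{R})\cap H^2(\mathbb{R}\setminus\{0\}) : f'(0+)-f'(0-)=-\gamma f(0)\}$$ acting by $-\Delta_\gamma f=-f''$ on $\mathbb{R}\setminus\{0\}$. For $s>0$ let $H^s(\mathbb{R})$ be the usual Sobolev space, with norm $\|f\|_{H^s}=\big(\int_{\mathbb{R}}(1+|\xi|^2)^s|\widehat f(\xi)|^2\,d\xi\big)^{1/2}$, where $\widehat f(\xi)=(2\pi)^{-1/2}\int_{\mathbb{R}} f(x)e^{-ix\xi}\,dx$. Then $-\Delta_\gamma+\lambda$ is a self-adjoint operator with an everywhere defined, bounded and nonnegative inverse, so that its fractional powers are defined by the functional calculus. For every $s\in(0,3/2)$, $$\mathcal{D}\big((-\Delta_\gamma+\lambda)^{s/2}\big)=H^s(\mathbb{R}),$$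 and there are constants $c,C>0$, depending only on $\gamma$, $\lambda$ and $s$, such that for all $f\in H^s(\mathbb{R})$ $$c\,\|f\|_{H^s}\le\big\|(-\Delta_\gamma+\lambda)^{s/2}f\big\|_{L^2}\le C\,\|f\|_{H^s}.$$ -/

import Mathlib

open MeasureTheory Filter Topology
open scoped ContDiff FourierTransform

namespace DeltaPotential

/-! ### Powers of strictly positive self-adjoint operators -/

section Power

variable {H : Type*} [NormedAddCommGroup H] [InnerProductSpace ℂ H]

/-- `R` is the everywhere defined bounded inverse of the unbounded operator `T`: the graph of `T`
is the set of all pairs `(R y, y)`, i.e. `T` is a bijection from its domain onto `H` with inverse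
`R`. -/
def IsBoundedInverse (T : H →ₗ.[ℂ] H) (R : H →L[ℂ] H) : Prop :=
  ∀ x y : H, (x, y) ∈ T.graph ↔ R y = x

theorem IsBoundedInverse.unique {T : H →ₗ.[ℂ] H} {R S : H →L[ℂ] H}
    (hR : IsBoundedInverse T R) (hS : IsBoundedInverse T S) : R = S := by
  ext y
  exact ((hS _ _).1 ((hR (R y) y).2 rfl)).symm

open Classical in
/-- The bounded inverse `T⁻¹` of an unbounded operator (with value `0` if there is none). -/
noncomputable def boundedInverse (T : H →ₗ.[ℂ] H) : H →L[ℂ] H :=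
  if h : ∃ R, IsBoundedInverse T R then h.choose else 0

theorem IsBoundedInverse.boundedInverse_eq {T : H →ₗ.[ℂ] H} {R : H →L[ℂ] H}
    (hR : IsBoundedInverse T R) : boundedInverse T = R := by
  have h : ∃ R, IsBoundedInverse T R := ⟨R, hR⟩
  rw [boundedInverse, dif_pos h]
  exact h.choose_spec.unique hR

/-- The power `T ^ α`, `α > 0`, of a self-adjoint operator `T ≥ c > 0`, given by the functional
calculus. The inverse `T⁻¹` is a bounded nonnegative self-adjoint operator, its power
`(T⁻¹) ^ α` is defined by the continuous functional calculus of bounded operators and is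
injective, and `T ^ α` is the unbounded operator inverse to `(T⁻¹) ^ α`. Its domain is the range
of `(T⁻¹) ^ α`. -/
noncomputable def fracPow [CompleteSpace H] (T : H →ₗ.[ℂ] H) (α : ℝ) : H →ₗ.[ℂ] H :=
  (((boundedInverse T ^ α : H →L[ℂ] H) : H →ₗ[ℂ] H).toPMap ⊤).inverse

end Power

/-! ### The Schrödinger operator with a delta potential -/

/-- The complex Hilbert space `L²(ℝ)`. -/
abbrev L2R : Type := Lp ℂ 2 (volume : Measure ℝ)

/-- `g` is the weak derivative of `f` on the open set `Ω` (for locally integrable `f`, `g`). -/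
def HasWeakDerivOn (Ω : Set ℝ) (f g : ℝ → ℂ) : Prop :=
  ∀ φ : ℝ → ℝ, ContDiff ℝ ∞ φ → HasCompactSupport φ → tsupport φ ⊆ Ω →
    ∫ x, deriv φ x • f x = -∫ x, φ x • g x

/-- `f` lies in `H¹(ℝ) ∩ H²(ℝ ∖ {0})`, satisfies `f'(0+) - f'(0-) = -γ f(0)`, and `u = -f''` on
`ℝ ∖ {0}`. Here `g` is the weak derivative of `f`; `F` is the continuous representative of `f`,
and `G` is the representative of `g` which is continuous away from `0`. -/
def IsDeltaLaplacian (γ : ℝ) (f u : L2R) : Prop :=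
  ∃ g : L2R, HasWeakDerivOn Set.univ f g ∧ HasWeakDerivOn {0}ᶜ g (-u : L2R) ∧
    ∃ (F G : ℝ → ℂ) (a b : ℂ), Continuous F ∧ f =ᵐ[volume] F ∧
      ContinuousOn G {0}ᶜ ∧ g =ᵐ[volume] G ∧
      Tendsto G (𝓝[>] 0) (𝓝 a) ∧ Tendsto G (𝓝[<] 0) (𝓝 b) ∧ a - b = -(γ : ℂ) * F 0

theorem integrable_smul_L2 {φ : ℝ → ℝ} (h : Continuous φ) (hc : HasCompactSupport φ) (f : L2R) :
    Integrable (fun x => φ x • f x) := by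
  have hf : LocallyIntegrable f :=
    (Lp.memLp f).locallyIntegrable (by norm_num)
  exact hf.integrable_smul_left_of_hasCompactSupport h hc

theorem HasWeakDerivOn.congr {Ω : Set ℝ} {f g f' g' : ℝ → ℂ} (h : HasWeakDerivOn Ω f g)
    (hf : f' =ᵐ[volume] f) (hg : g' =ᵐ[volume] g) : HasWeakDerivOn Ω f' g' := by
  intro φ h1 h2 h3
  have e1 : ∫ x, deriv φ x • f' x = ∫ x, deriv φ x • f x :=
    integral_congr_ae (by filter_upwards [hf] with x hx; rw [hx])
  have e2 : ∫ x, φ x • g' x = ∫ x, φ x • g x :=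
    integral_congr_ae (by filter_upwards [hg] with x hx; rw [hx])
  rw [e1, e2, h φ h1 h2 h3]

theorem HasWeakDerivOn.add {Ω : Set ℝ} {f g f' g' : L2R} (h : HasWeakDerivOn Ω f g)
    (h' : HasWeakDerivOn Ω f' g') : HasWeakDerivOn Ω (f + f' : L2R) (g + g' : L2R) := by
  have key : HasWeakDerivOn Ω (⇑f + ⇑f') (⇑g + ⇑g') := by
    intro φ h1 h2 h3
    have c1 : Continuous (deriv φ) := h1.continuous_deriv (by norm_num)
    simp only [Pi.add_apply, smul_add]
    rw [integral_add (integrable_smul_L2 c1 h2.deriv f) (integrable_smul_L2 c1 h2.deriv f'),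
      integral_add (integrable_smul_L2 h1.continuous h2 g) (integrable_smul_L2 h1.continuous h2 g'),
      h φ h1 h2 h3, h' φ h1 h2 h3]
    ring
  exact key.congr (Lp.coeFn_add _ _) (Lp.coeFn_add _ _)

theorem HasWeakDerivOn.smul {Ω : Set ℝ} {f g : L2R} (c : ℂ) (h : HasWeakDerivOn Ω f g) :
    HasWeakDerivOn Ω (c • f : L2R) (c • g : L2R) := by
  have key : HasWeakDerivOn Ω (c • ⇑f) (c • ⇑g) := by
    intro φ h1 h2 h3
    simp only [Pi.smul_apply, smul_comm _ c]
    rw [integral_smul, integral_smul, h φ h1 h2 h3, smul_neg]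
  exact key.congr (Lp.coeFn_smul _ _) (Lp.coeFn_smul _ _)

theorem hasWeakDerivOn_zero (Ω : Set ℝ) : HasWeakDerivOn Ω (0 : L2R) (0 : L2R) := by
  have key : HasWeakDerivOn Ω 0 0 := by
    intro φ _ _ _
    simp
  exact key.congr (Lp.coeFn_zero _ _ _) (Lp.coeFn_zero _ _ _)

theorem HasWeakDerivOn.eq_zero {Ω : Set ℝ} (hΩ : IsOpen Ω) (hc : volume Ωᶜ = 0) {g : L2R}
    (h : HasWeakDerivOn Ω (0 : L2R) g) : g = 0 := by
  have h0 : HasWeakDerivOn Ω 0 g := h.congr (Lp.coeFn_zero _ _ _).symm (ae_eq_refl _)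
  have hg : LocallyIntegrable g := (Lp.memLp g).locallyIntegrable (by norm_num)
  have := hΩ.ae_eq_zero_of_integral_contDiff_smul_eq_zero (hg.locallyIntegrableOn Ω)
    (fun φ h1 h2 h3 => by
      have := h0 φ h1 h2 h3
      simpa using this.symm)
  rw [Lp.eq_zero_iff_ae_eq_zero]
  have hmem : ∀ᵐ x ∂(volume : Measure ℝ), x ∈ Ω := by
    rw [ae_iff]; exact hc
  filter_upwards [this, hmem] with x hx hx'
  exact hx hx'

/-- The graph of the operator `-Δ_γ`. -/
def deltaGraph (γ : ℝ) : Submodule ℂ (L2R × L2R) where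
  carrier := {p | IsDeltaLaplacian γ p.1 p.2}
  zero_mem' := by
    refine ⟨0, hasWeakDerivOn_zero _, ?_, 0, 0, 0, 0, continuous_zero, Lp.coeFn_zero _ _ _,
      continuousOn_const, Lp.coeFn_zero _ _ _, tendsto_const_nhds, tendsto_const_nhds, by simp⟩
    simpa using hasWeakDerivOn_zero _
  add_mem' := by
    rintro ⟨f, u⟩ ⟨f', u'⟩ ⟨g, h1, h2, F, G, a, b, h3, h4, h5, h6, h7, h8, h9⟩
      ⟨g', h1', h2', F', G', a', b', h3', h4', h5', h6', h7', h8', h9'⟩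
    refine ⟨g + g', h1.add h1', ?_, F + F', G + G', a + a', b + b', h3.add h3',
      (Lp.coeFn_add _ _).trans (h4.add h4'), h5.add h5',
      (Lp.coeFn_add _ _).trans (h6.add h6'), h7.add h7', h8.add h8', ?_⟩
    · have := h2.add h2'
      rwa [← neg_add] at this
    · simp only [Pi.add_apply]
      linear_combination h9 + h9'
  smul_mem' := by
    rintro c ⟨f, u⟩ ⟨g, h1, h2, F, G, a, b, h3, h4, h5, h6, h7, h8, h9⟩
    refine ⟨c • g, h1.smul c, ?_, c • F, c • G, c * a, c * b, h3.const_smul c,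
      (Lp.coeFn_smul _ _).trans (h4.const_smul c), h5.const_smul c,
      (Lp.coeFn_smul _ _).trans (h6.const_smul c), h7.const_mul c, h8.const_mul c, ?_⟩
    · have := h2.smul c
      rwa [smul_neg] at this
    · simp only [Pi.smul_apply, smul_eq_mul]
      linear_combination c * h9

/-- The set `deltaGraph γ` is the graph of an operator. -/
theorem deltaGraph_single_valued (γ : ℝ) (p : L2R × L2R) (hp : p ∈ deltaGraph γ)
    (h0 : p.1 = 0) : p.2 = 0 := by
  obtain ⟨f, u⟩ := p
  obtain ⟨g, h1, h2, -⟩ := hp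
  simp only at h0 h1 h2 ⊢
  subst h0
  have hg : g = 0 := h1.eq_zero isOpen_univ (by simp)
  subst hg
  have := h2.eq_zero isOpen_compl_singleton (by simp)
  simpa using this

/-- The operator `-Δ_γ = -∂ₓ² - γ δ` on `L²(ℝ)`, with domain
`{f ∈ H¹(ℝ) ∩ H²(ℝ ∖ {0}) : f'(0+) - f'(0-) = -γ f(0)}` and action `f ↦ -f''`. -/
noncomputable def negDelta (γ : ℝ) : L2R →ₗ.[ℂ] L2R := (deltaGraph γ).toLinearPMap

theorem negDelta_graph (γ : ℝ) : (negDelta γ).graph = deltaGraph γ :=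
  (deltaGraph γ).toLinearPMap_graph_eq (deltaGraph_single_valued γ)

/-- The operator `-Δ_γ + lam`, with the domain of `-Δ_γ`. -/
noncomputable def negDeltaAdd (γ lam : ℝ) : L2R →ₗ.[ℂ] L2R :=
  ((lam : ℂ) • (LinearMap.id : L2R →ₗ[ℂ] L2R)) +ᵥ negDelta γ

/-! ### The Sobolev norm -/

/-- `ξ ↦ (1 + |2πξ|²)^{s/2} 𝓕 f (ξ)`, where `𝓕 f (ξ) = ∫ f(x) e^{-2πixξ} dx`. -/
noncomputable def sobolevWeighted (s : ℝ) (f : L2R) (ξ : ℝ) : ℂ :=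
  ((1 + (2 * Real.pi * ξ) ^ 2) ^ (s / 2) : ℝ) • (𝓕 f : L2R) ξ

/-- The norm `‖f‖_{H^s} = (∫ (1 + |ξ|²)^s |f̂(ξ)|² dξ)^{1/2}` for the unitary Fourier transform
`f̂(ξ) = (2π)^{-1/2} ∫ f(x) e^{-ixξ} dx`. In terms of `𝓕` it is the `L²` norm of
`(1 + |2πξ|²)^{s/2} 𝓕 f (ξ)`. -/
noncomputable def sobolevNorm (s : ℝ) (f : L2R) : ℝ :=
  (eLpNorm (sobolevWeighted s f) 2 volume).toReal

end DeltaPotential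

namespace DeltaPotential

open BoundedContinuousFunction

/-! ### Multiplication operators on `L²(ℝ)` -/

/-! In Fourier variables the free resolvent is multiplication by `1 / symb lam`. Since `-Δ_γ f = u`
means `-f'' = u + γ f(0) δ` on the whole line, Krein's formula holds: the inverse of `-Δ_γ + lam` is
`fourierRes γ lam`, the free resolvent plus a multiple of the rank one operator built on `symbInv
lam` (`isDeltaLaplacian_iff`). The self-consistent value of `f(0)` fixes the coefficient. It is
finite and the operator is nonnegative because `γ < 2√lam`, which is what the conditions on `lam`
amount to.

Write `a` for the perturbed resolvent, `b` for the free one and `α = s / 2 ∈ (0, 3/4)`.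
Balakrishnan's formula writes `a ^ α` and `b ^ α` as integrals of the resolvents at `lam + t⁻¹`
against `t ^ (α - 2)`. At each shift the two resolvents differ by a rank one operator. Its left
vector is `symb lam ^ (-α)` times the weight `symb lam ^ α / symb (lam + t)`, which is square
integrable exactly because `α < 3/4`. Hence `a ^ α - b ^ α = b ^ α B`, with `B` a convergent
integral of rank one operators and so compact.

Thus `a ^ α = b ^ α (1 + B)`. As `a ^ α` is injective, `-1` is not an eigenvalue of `B`, and the
Fredholm alternative makes `1 + B` invertible (`exists_equiv_rpow_eq_comp`). Therefore `a ^ α` and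
`b ^ α` have the same range, with equivalent norms. The range of `b ^ α` is the space of Fourier
transforms of `H^s` (`memSobolev_iff`, `exists_sobolevNorm_eq`), which gives both claims. -/

theorem memLp_mul_bcf (w : ℝ →ᵇ ℂ) (f : L2R) : MemLp (fun x => w x * f x) 2 volume :=
  (Lp.memLp f).mul
    (memLp_top_of_bound w.continuous.aestronglyMeasurable ‖w‖ (.of_forall w.norm_coe_le_norm))

theorem norm_toLp_mul_bcf_le (w : ℝ →ᵇ ℂ) (f : L2R) :
    ‖(memLp_mul_bcf w f).toLp _‖ ≤ ‖w‖ * ‖f‖ := by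
  refine Lp.norm_le_mul_norm_of_ae_le_mul ?_
  filter_upwards [(memLp_mul_bcf w f).coeFn_toLp] with x hx
  rw [hx, norm_mul]
  gcongr
  exact w.norm_coe_le_norm x

/-- The operator of multiplication by a bounded continuous function. -/
noncomputable def mulOp (w : ℝ →ᵇ ℂ) : L2R →L[ℂ] L2R :=
  LinearMap.mkContinuous
    { toFun := fun f => (memLp_mul_bcf w f).toLp _
      map_add' := fun f g => by
        apply Lp.ext
        filter_upwards [(memLp_mul_bcf w (f + g)).coeFn_toLp, (memLp_mul_bcf w f).coeFn_toLp,
          (memLp_mul_bcf w g).coeFn_toLp, Lp.coeFn_add f g,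
          Lp.coeFn_add ((memLp_mul_bcf w f).toLp _) ((memLp_mul_bcf w g).toLp _)]
          with x h1 h2 h3 h4 h5
        rw [h5, h1, Pi.add_apply, h2, h3, h4, Pi.add_apply, mul_add]
      map_smul' := fun c f => by
        apply Lp.ext
        filter_upwards [(memLp_mul_bcf w (c • f)).coeFn_toLp, (memLp_mul_bcf w f).coeFn_toLp,
          Lp.coeFn_smul c f, Lp.coeFn_smul c ((memLp_mul_bcf w f).toLp _)] with x h1 h2 h3 h4
        simp only [RingHom.id_apply]
        rw [h4, h1, Pi.smul_apply, h2, h3, Pi.smul_apply, smul_eq_mul, smul_eq_mul]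
        ring }
    ‖w‖ fun f => norm_toLp_mul_bcf_le w f

theorem mulOp_coeFn (w : ℝ →ᵇ ℂ) (f : L2R) : mulOp w f =ᵐ[volume] fun x => w x * f x :=
  (memLp_mul_bcf w f).coeFn_toLp

theorem norm_mulOp_le (w : ℝ →ᵇ ℂ) : ‖mulOp w‖ ≤ ‖w‖ :=
  LinearMap.mkContinuous_norm_le _ (norm_nonneg _) _

theorem mulOp_mul_apply (v w : ℝ →ᵇ ℂ) (f : L2R) : mulOp (v * w) f = mulOp v (mulOp w f) := by
  apply Lp.ext
  filter_upwards [mulOp_coeFn (v * w) f, mulOp_coeFn v (mulOp w f), mulOp_coeFn w f]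
    with x h1 h2 h3
  rw [h1, h2, h3, BoundedContinuousFunction.mul_apply, mul_assoc]

theorem mulOp_one_apply (f : L2R) : mulOp 1 f = f := by
  apply Lp.ext
  filter_upwards [mulOp_coeFn 1 f] with x h1
  rw [h1]; simp

theorem inner_mulOp_left (w : ℝ →ᵇ ℂ) (f g : L2R) :
    inner ℂ (mulOp w f) g = inner ℂ f (mulOp (star w) g) := by
  rw [L2.inner_def, L2.inner_def]
  apply integral_congr_ae
  filter_upwards [mulOp_coeFn w f, mulOp_coeFn (star w) g] with x h1 h2
  simp only [RCLike.inner_apply, h1, h2, map_mul, BoundedContinuousFunction.star_apply]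
  simp only [RCLike.star_def]
  ring

/-- Multiplication operators form a representation of the bounded continuous functions. -/
noncomputable def mulOpHom : (ℝ →ᵇ ℂ) →⋆ₐ[ℂ] (L2R →L[ℂ] L2R) where
  toFun := mulOp
  map_one' := by ext1 f; exact mulOp_one_apply f
  map_mul' v w := by ext1 f; exact mulOp_mul_apply v w f
  map_zero' := by
    ext1 f
    apply Lp.ext
    filter_upwards [mulOp_coeFn 0 f, Lp.coeFn_zero ℂ 2 (volume : Measure ℝ)] with x h1 h2
    rw [h1]
    exact (zero_mul _).trans h2.symm
  map_add' v w := by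
    ext1 f
    apply Lp.ext
    filter_upwards [mulOp_coeFn (v + w) f, mulOp_coeFn v f, mulOp_coeFn w f,
      Lp.coeFn_add (mulOp v f) (mulOp w f)] with x h1 h2 h3 h4
    rw [_root_.add_apply, h4, h1, Pi.add_apply, h2, h3,
      BoundedContinuousFunction.add_apply, add_mul]
  commutes' c := by
    ext1 f
    apply Lp.ext
    filter_upwards [mulOp_coeFn (algebraMap ℂ (ℝ →ᵇ ℂ) c) f, Lp.coeFn_smul c f] with x h1 h2
    rw [h1, Algebra.algebraMap_eq_smul_one (A := L2R →L[ℂ] L2R)]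
    refine Eq.trans ?_ h2.symm
    simp [Algebra.algebraMap_eq_smul_one]
  map_star' w := by
    rw [ContinuousLinearMap.star_eq_adjoint, ContinuousLinearMap.eq_adjoint_iff]
    intro f g
    rw [inner_mulOp_left, star_star]

theorem continuous_mulOpHom : Continuous mulOpHom :=
  AddMonoidHomClass.continuous_of_bound mulOpHom 1 fun w => by
    rw [one_mul]; exact norm_mulOp_le w

/-- Evaluation at a point as a homomorphism on the bounded continuous functions. -/
noncomputable def evalHom (x : ℝ) : (ℝ →ᵇ ℂ) →⋆ₐ[ℂ] ℂ where
  toFun w := w x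
  map_one' := rfl
  map_mul' _ _ := rfl
  map_zero' := rfl
  map_add' _ _ := rfl
  commutes' c := by simp [Algebra.algebraMap_eq_smul_one]
  map_star' _ := rfl

theorem mulOp_nonneg {w : ℝ →ᵇ ℂ} (r : ℝ → ℝ) (hr : ∀ x, 0 ≤ r x) (hw : ∀ x, w x = r x) :
    0 ≤ mulOp w := by
  rw [ContinuousLinearMap.nonneg_iff_isPositive, ContinuousLinearMap.isPositive_iff]
  have hs : star w = w := by ext x; simp [hw]
  refine ⟨fun f g => ?_, fun f => ?_⟩
  · have := inner_mulOp_left w f g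
    rwa [hs] at this
  · rw [L2.inner_def]
    have : ∀ᵐ x ∂(volume : Measure ℝ), inner ℂ (mulOp w f x) (f x)
        = ((r x * ‖f x‖ ^ 2 : ℝ) : ℂ) := by
      filter_upwards [mulOp_coeFn w f] with x h1
      rw [h1, hw]
      simp only [RCLike.inner_apply, map_mul, Complex.conj_ofReal]
      rw [mul_comm, mul_assoc, mul_comm _ (f x), Complex.mul_conj, Complex.normSq_eq_norm_sq]
      push_cast; rfl
    rw [integral_congr_ae this, integral_complex_ofReal]
    rw [Complex.zero_le_real]
    exact integral_nonneg fun x => mul_nonneg (hr x) (sq_nonneg _)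

/-- The continuous functional calculus commutes with continuous star homomorphisms. Applied to `Φ`,
this moves the power into the algebra of bounded continuous functions. Applied to the point
evaluations, it identifies the power there with the pointwise one. -/
theorem map_bcf_rpow {H : Type*} [NormedAddCommGroup H] [InnerProductSpace ℂ H] [CompleteSpace H]
    (Φ : (ℝ →ᵇ ℂ) →⋆ₐ[ℂ] (H →L[ℂ] H)) (hΦ : Continuous Φ) {w v : ℝ →ᵇ ℂ} {α : ℝ} (hα : 0 ≤ α)
    (r : ℝ → ℝ) (hw : ∀ x, w x = r x) (hv : ∀ x, v x = ((r x ^ α : ℝ) : ℂ)) (h0 : 0 ≤ Φ w) :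
    Φ w ^ α = Φ v := by
  have : ContinuousFunctionalCalculus ℝ (ℝ →ᵇ ℂ) IsSelfAdjoint :=
    IsSelfAdjoint.instContinuousFunctionalCalculus
  have hc : Continuous fun x : ℝ => x ^ α := Real.continuous_rpow_const hα
  have hsa : IsSelfAdjoint w := by ext x; simp [hw]
  rw [CFC.rpow_eq_cfc_real h0, ← StarAlgHomClass.map_cfc Φ (fun x : ℝ => x ^ α) w hc.continuousOn
    hΦ hsa (hsa.map Φ)]
  congr 1
  ext x
  have h1 := StarAlgHomClass.map_cfc (evalHom x) (fun x : ℝ => x ^ α) w hc.continuousOn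
    (continuous_eval_const (F := ℝ →ᵇ ℂ) x) hsa (hsa.map (evalHom x))
  have h2 : evalHom x w = algebraMap ℝ ℂ (r x) := hw x
  rw [h2, cfc_algebraMap] at h1
  rw [hv]
  exact h1

end DeltaPotential

namespace DeltaPotential

/-! ### Fractional powers of bounded nonnegative operators -/

section Power

variable {H : Type*} [NormedAddCommGroup H] [InnerProductSpace ℂ H] [CompleteSpace H]

-- Balakrishnan's formula holds for numbers `z ≥ 0`. On the spectrum the integrand is monotone in
-- `z`, so its value at `‖a‖` dominates it uniformly, and the functional calculus may be exchanged
-- with the integral.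
open Real in
theorem integrableOn_cfc_rpowIntegrand_and_rpow_eq {a : H →L[ℂ] H} (ha : 0 ≤ a) {p : ℝ}
    (hp : p ∈ Set.Ioo 0 1) :
    IntegrableOn (fun t => cfc (rpowIntegrand₀₁ p t) a) (Set.Ioi 0) ∧
    a ^ p = (∫ t in Set.Ioi 0, rpowIntegrand₀₁ p t 1)⁻¹ •
      ∫ t in Set.Ioi 0, cfc (rpowIntegrand₀₁ p t) a := by
  rcases subsingleton_or_nontrivial (H →L[ℂ] H) with hH | hH
  · refine ⟨?_, Subsingleton.elim _ _⟩
    have : (fun t => cfc (rpowIntegrand₀₁ p t) a) = 0 := funext fun t => Subsingleton.elim _ _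
    rw [this]
    exact integrableOn_zero
  have hs : ∀ z ∈ spectrum ℝ a, 0 ≤ z := fun z hz => spectrum_nonneg_of_nonneg ha hz
  have hb : ∀ z ∈ spectrum ℝ a, z ≤ ‖a‖ := fun z hz =>
    (le_abs_self z).trans (spectrum.norm_le_norm_of_mem hz)
  have hf : ContinuousOn (Function.uncurry (rpowIntegrand₀₁ p)) (Set.Ioi (0 : ℝ) ×ˢ spectrum ℝ a) :=
    continuousOn_rpowIntegrand₀₁_uncurry hp _ fun z hz => hs z hz
  have hbound : ∀ᵐ t ∂(volume : Measure ℝ).restrict (Set.Ioi 0), ∀ z ∈ spectrum ℝ a,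
      ‖rpowIntegrand₀₁ p t z‖ ≤ rpowIntegrand₀₁ p t ‖a‖ := by
    filter_upwards [ae_restrict_mem measurableSet_Ioi] with t (ht : 0 < t) z hz
    rw [Real.norm_of_nonneg (rpowIntegrand₀₁_nonneg hp.1 ht.le (hs z hz))]
    exact rpowIntegrand₀₁_monotoneOn hp ht.le (hs z hz) (norm_nonneg a) (hb z hz)
  have hfin : HasFiniteIntegral (fun t => rpowIntegrand₀₁ p t ‖a‖)
      ((volume : Measure ℝ).restrict (Set.Ioi 0)) :=
    (integrableOn_rpowIntegrand₀₁_Ioi hp (norm_nonneg a)).2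
  refine ⟨integrableOn_cfc measurableSet_Ioi _ _ a hf hbound hfin, ?_⟩
  rw [← cfc_setIntegral measurableSet_Ioi _ _ a hf hbound hfin ha.isSelfAdjoint,
    CFC.rpow_eq_cfc_real ha]
  have hne := (integral_rpowIntegrand₀₁_one_pos hp).ne'
  have hc : ContinuousOn (fun z : ℝ => ∫ t in Set.Ioi 0, rpowIntegrand₀₁ p t z) (spectrum ℝ a) := by
    refine ContinuousOn.congr (f := fun z => z ^ p * ∫ t in Set.Ioi 0, rpowIntegrand₀₁ p t 1) ?_
      fun z hz => integral_rpowIntegrand₀₁_eq_rpow_mul_const hp (hs z hz)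
    exact ((Real.continuous_rpow_const hp.1.le).mul continuous_const).continuousOn
  rw [← cfc_smul _ _ a hc]
  exact cfc_congr fun z hz => rpow_eq_const_mul_integral hp (hs z hz)

-- The integrand is `t ^ (p - 1) z / (t + z) = t ^ (p - 2) z / (1 + t⁻¹ z)`, and `1 + t⁻¹ • a` is a
-- unit since the spectrum of `a` is nonnegative. If `a = T⁻¹` then `X = (T + t⁻¹)⁻¹`, so the
-- hypothesis on `X` is the resolvent identity.
open Real in
theorem cfc_rpowIntegrand_eq {a X : H →L[ℂ] H} (ha : 0 ≤ a) {p t : ℝ} (hp : p ∈ Set.Ioo 0 1)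
    (ht : 0 < t) (hX : X * (1 + t⁻¹ • a) = a) :
    cfc (rpowIntegrand₀₁ p t) a = t ^ (p - 2) • X := by
  have hs : ∀ z ∈ spectrum ℝ a, 0 ≤ z := fun z hz => spectrum_nonneg_of_nonneg ha hz
  have hsa := ha.isSelfAdjoint
  have hg : cfc (fun z : ℝ => 1 + t⁻¹ * z) a = 1 + t⁻¹ • a := by
    rw [cfc_const_add (1 : ℝ) (fun z : ℝ => t⁻¹ * z) a, cfc_const_mul_id t⁻¹ a, map_one]
  have hu : IsUnit (1 + t⁻¹ • a) := by
    rw [← hg, isUnit_cfc_iff (fun z : ℝ => 1 + t⁻¹ * z) a]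
    intro z hz
    have := hs z hz
    positivity
  rw [← hu.mul_left_inj, smul_mul_assoc, hX, ← hg, ← cfc_mul _ _ a
    ((continuousOn_rpowIntegrand₀₁_Ici hp ht).mono hs)]
  rw [← cfc_const_mul_id (t ^ (p - 2)) a]
  refine cfc_congr fun z hz => ?_
  have hz := hs z hz
  rw [rpowIntegrand₀₁_eq_pow_div hp ht.le hz, show p - 1 = p - 2 + 1 by ring,
    Real.rpow_add_one ht.ne']
  field_simp

/-- From `a = a ^ (1 - p) * a ^ p`, the kernel of `a ^ p` lies in that of `a`. -/
theorem rpow_apply_eq_zero {a : H →L[ℂ] H} (ha : 0 ≤ a) (hinj : ∀ y, a y = 0 → y = 0) {p : ℝ}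
    (hp : p ∈ Set.Ioo 0 1) (y : H) (hy : (a ^ p) y = 0) : y = 0 := by
  apply hinj
  have hs : ∀ z ∈ spectrum ℝ a, 0 ≤ z := fun z hz => spectrum_nonneg_of_nonneg ha hz
  have h : a ^ (1 - p) * a ^ p = a := by
    rw [CFC.rpow_eq_cfc_real ha, CFC.rpow_eq_cfc_real ha, ← cfc_mul _ _ a
      (Real.continuous_rpow_const (by linarith [hp.2])).continuousOn
      (Real.continuous_rpow_const hp.1.le).continuousOn]
    conv_rhs => rw [← cfc_id ℝ a ha.isSelfAdjoint]
    refine cfc_congr fun z hz => ?_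
    simp only [id]
    -- The value `z = 0` is allowed because the exponents add up to `1 ≠ 0`.
    rw [← Real.rpow_add' (hs z hz) (by simp)]
    simp
  rw [← h, mul_apply_eq_comp, hy, map_zero]

/-- If the resolvent families `X` and `Y` of the inverses of `a` and `b` differ by compact operators
that factor through `b ^ p` with suitable bounds, then `a ^ p` and `b ^ p` differ by
an invertible right factor. -/
theorem exists_equiv_rpow_eq_comp {a b : H →L[ℂ] H} (ha : 0 ≤ a) (hb : 0 ≤ b)
    (hinj : ∀ y, a y = 0 → y = 0) {p : ℝ} (hp : p ∈ Set.Ioo 0 1) {X Y E : ℝ → H →L[ℂ] H}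
    (hX : ∀ t, 0 < t → X t * (1 + t • a) = a) (hY : ∀ t, 0 < t → Y t * (1 + t • b) = b)
    (hE : ∀ t, 0 < t → X t - Y t = (b ^ p) ∘L E t) (hcomp : ∀ t, IsCompactOperator (E t))
    (hint : IntegrableOn (fun t : ℝ => t ^ (p - 2) • E t⁻¹) (Set.Ioi 0)) :
    ∃ A : H ≃L[ℂ] H, a ^ p = (b ^ p) ∘L (A : H →L[ℂ] H) := by
  obtain ⟨ia, ea⟩ := integrableOn_cfc_rpowIntegrand_and_rpow_eq ha hp
  obtain ⟨ib, eb⟩ := integrableOn_cfc_rpowIntegrand_and_rpow_eq hb hp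
  set C := (∫ t in Set.Ioi 0, Real.rpowIntegrand₀₁ p t 1)⁻¹ with hC
  set B : H →L[ℂ] H := C • ∫ t in Set.Ioi (0 : ℝ), t ^ (p - 2) • E t⁻¹ with hB
  have hdiff : a ^ p - b ^ p = (b ^ p) ∘L B := by
    rw [ea, eb, ← smul_sub, ← integral_sub ia ib, hB, ContinuousLinearMap.comp_smul]
    congr 1
    have h1 : (b ^ p) ∘L (∫ t in Set.Ioi (0 : ℝ), t ^ (p - 2) • E t⁻¹)
        = ∫ t in Set.Ioi (0 : ℝ), (b ^ p) ∘L (t ^ (p - 2) • E t⁻¹) :=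
      ((ContinuousLinearMap.compL ℂ H H H (b ^ p)).integral_comp_comm hint).symm
    rw [← eb, h1]
    refine setIntegral_congr_fun measurableSet_Ioi fun t (ht : 0 < t) => ?_
    rw [cfc_rpowIntegrand_eq ha hp ht (hX _ (inv_pos.2 ht)),
      cfc_rpowIntegrand_eq hb hp ht (hY _ (inv_pos.2 ht)), ← smul_sub, hE _ (inv_pos.2 ht),
      ContinuousLinearMap.comp_smul]
  have hBc : IsCompactOperator B := by
    -- The compact operators form a closed, hence complete, subspace, so the Bochner integral can be
    -- taken inside it.
    let V : Submodule ℂ (H →L[ℂ] H) := compactOperator (RingHom.id ℂ) H H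
    have hV : IsClosed (V : Set (H →L[ℂ] H)) := isClosed_setOfPred_isCompactOperator
    have : CompleteSpace V := hV.completeSpace_coe
    have hmem := V.subtypeₗᵢ.integral_comp_comm (μ := volume.restrict (Set.Ioi (0 : ℝ)))
      (fun t : ℝ => ⟨t ^ (p - 2) • E t⁻¹, (hcomp t⁻¹).smul (t ^ (p - 2))⟩)
    simp only [Submodule.coe_subtypeₗᵢ, Submodule.subtype_apply] at hmem
    have hsmul : ∀ I : V, IsCompactOperator (C • (I : H →L[ℂ] H)) := fun I =>
      IsCompactOperator.smul (show IsCompactOperator (I : H →L[ℂ] H) from I.2) C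
    rw [hB, hmem]
    exact hsmul _
  have hfac : a ^ p = (b ^ p) ∘L (1 + B) := by
    rw [ContinuousLinearMap.comp_add, ← hdiff]
    ext x; simp
  -- If `B x = -x`, then `a ^ p x = b ^ p (x + B x) = 0`, so `x = 0` by injectivity of `a ^ p`.
  have hnot : ¬ Module.End.HasEigenvalue (B : Module.End ℂ H) (-1) := by
    intro h
    obtain ⟨x, hx⟩ := h.exists_hasEigenvector
    apply hx.2
    apply rpow_apply_eq_zero ha hinj hp
    have hx1 : B x = -x := by simpa using hx.apply_eq_smul
    rw [hfac]
    simp [hx1]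
  have hres := (hBc.hasEigenvalue_or_mem_resolventSet (neg_ne_zero.2 one_ne_zero)).resolve_left hnot
  have hu : IsUnit (1 + B) := by
    rw [spectrum.mem_resolventSet_iff] at hres
    have : 1 + B = -(algebraMap ℂ (H →L[ℂ] H) (-1) - B) := by rw [map_neg, map_one]; abel
    rw [this]
    exact hres.neg
  obtain ⟨U, hU⟩ := hu
  refine ⟨ContinuousLinearEquiv.unitsEquiv ℂ H U, ?_⟩
  rw [hfac, ← hU]
  rfl

/-- The power `a ^ α` given by the continuous functional calculus. -/
noncomputable abbrev opPow (a : H →L[ℂ] H) (α : ℝ) : H →L[ℂ] H := a ^ α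

end Power

end DeltaPotential

namespace DeltaPotential

open BoundedContinuousFunction

/-! ### Powers of the symbol `lam + (2πξ)²` -/

/-- The symbol of `-d²/dx² + lam`. -/
noncomputable def symb (lam ξ : ℝ) : ℝ := lam + (2 * Real.pi * ξ) ^ 2

theorem le_symb (lam ξ : ℝ) : lam ≤ symb lam ξ := le_add_of_nonneg_right (sq_nonneg _)

theorem symb_pos {lam : ℝ} (h : 0 < lam) (ξ : ℝ) : 0 < symb lam ξ := h.trans_le (le_symb lam ξ)

theorem symb_add (lam t ξ : ℝ) : symb (lam + t) ξ = symb lam ξ + t := by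
  simp only [symb]; ring

theorem continuous_symb (lam : ℝ) : Continuous (symb lam) := by
  unfold symb; fun_prop

theorem continuous_symb_rpow {lam : ℝ} (h : 0 < lam) (β : ℝ) :
    Continuous fun ξ => symb lam ξ ^ β :=
  (continuous_symb lam).rpow_const fun ξ => .inl (symb_pos h ξ).ne'

theorem one_add_sq_le_symb {lam : ℝ} (ξ : ℝ) :
    min lam 1 * (1 + ξ ^ 2) ≤ symb lam ξ := by
  have h1 : min lam 1 * 1 ≤ lam := by rw [mul_one]; exact min_le_left _ _
  have h2 : min lam 1 * ξ ^ 2 ≤ 1 * ξ ^ 2 :=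
    mul_le_mul_of_nonneg_right (min_le_right _ _) (sq_nonneg _)
  have h3 : ξ ^ 2 ≤ (2 * Real.pi * ξ) ^ 2 := by
    rw [mul_pow]
    exact le_mul_of_one_le_left (sq_nonneg _) (by nlinarith [Real.pi_gt_three])
  unfold symb
  linarith

theorem integrable_symb_rpow {lam : ℝ} (h : 0 < lam) {β : ℝ} (hβ : 1 / 2 < β) :
    Integrable fun ξ => symb lam ξ ^ (-β) := by
  have hk : 0 < min lam 1 := lt_min h one_pos
  have h0 : Integrable fun ξ : ℝ => (min lam 1) ^ (-β) * (1 + ‖ξ‖ ^ 2) ^ (-(2 * β) / 2) :=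
    (integrable_rpow_neg_one_add_norm_sq (by simp; linarith)).const_mul _
  refine h0.mono' (continuous_symb_rpow h _).aestronglyMeasurable (.of_forall fun ξ => ?_)
  rw [Real.norm_of_nonneg (Real.rpow_nonneg (symb_pos h ξ).le _),
    show -(2 * β) / 2 = -β by ring, ← Real.mul_rpow hk.le (by positivity), Real.norm_eq_abs, sq_abs]
  exact Real.rpow_le_rpow_of_nonpos (by positivity) (one_add_sq_le_symb ξ) (by linarith)

/-- The square decays like `|ξ| ^ (-4β)`. This is where the restriction `s < 3/2` originates: it is
used with `β = 1 - α` and `α = s / 2`. -/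
theorem memLp_symb_rpow {lam : ℝ} (h : 0 < lam) {β : ℝ} (hβ : 1 / 4 < β) :
    MemLp (fun ξ => symb lam ξ ^ (-β)) 2 volume := by
  rw [memLp_two_iff_integrable_sq (continuous_symb_rpow h _).aestronglyMeasurable]
  refine (integrable_symb_rpow h (β := 2 * β) (by linarith)).congr (.of_forall fun ξ => ?_)
  simp only
  rw [← Real.rpow_mul_natCast (symb_pos h ξ).le]
  congr 1; push_cast; ring

/-- Rescaling reduces this to the integral of `1 / (1 + x²)`. The value is that at `0` of the free
Green's function `e^{-√lam |x|} / (2√lam)`. -/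
theorem integral_symb_inv {lam : ℝ} (h : 0 < lam) :
    ∫ ξ, (symb lam ξ)⁻¹ = (2 * Real.sqrt lam)⁻¹ := by
  have hs : 0 < Real.sqrt lam := Real.sqrt_pos.2 h
  have hsq : Real.sqrt lam ^ 2 = lam := Real.sq_sqrt h.le
  have hpi := Real.pi_pos
  have key : ∀ ξ, (symb lam ξ)⁻¹ =
      lam⁻¹ * (fun x : ℝ => (1 + x ^ 2)⁻¹) ((2 * Real.pi / Real.sqrt lam) * ξ) := by
    intro ξ
    simp only
    rw [← mul_inv]
    congr 1
    unfold symb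
    rw [mul_pow _ ξ, mul_pow _ ξ, div_pow, hsq]
    field_simp
  simp_rw [key]
  rw [integral_const_mul, Measure.integral_comp_mul_left (fun x : ℝ => (1 + x ^ 2)⁻¹),
    integral_univ_inv_one_add_sq, abs_of_pos (by positivity), smul_eq_mul]
  nth_rewrite 1 [← hsq]
  field_simp

/-- The function `symb lam ξ ^ (-β)` as a bounded continuous multiplier (`0` unless `0 < lam` and
`0 ≤ β`). -/
noncomputable def powBcf (lam β : ℝ) : ℝ →ᵇ ℂ :=
  if h : 0 < lam ∧ 0 ≤ β then
    BoundedContinuousFunction.ofNormedAddCommGroup (fun ξ => ((symb lam ξ ^ (-β) : ℝ) : ℂ))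
      (Complex.continuous_ofReal.comp (continuous_symb_rpow h.1 _)) (lam ^ (-β)) fun ξ => by
        rw [Complex.norm_real, Real.norm_of_nonneg (Real.rpow_nonneg (symb_pos h.1 ξ).le _)]
        exact Real.rpow_le_rpow_of_nonpos h.1 (le_symb _ _) (by linarith [h.2])
  else 0

theorem powBcf_apply {lam β : ℝ} (h : 0 < lam) (hβ : 0 ≤ β) (ξ : ℝ) :
    powBcf lam β ξ = ((symb lam ξ ^ (-β) : ℝ) : ℂ) := by
  rw [powBcf, dif_pos ⟨h, hβ⟩]; rfl

theorem powBcf_one_apply {lam : ℝ} (h : 0 < lam) (ξ : ℝ) :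
    powBcf lam 1 ξ = (((symb lam ξ)⁻¹ : ℝ) : ℂ) := by
  rw [powBcf_apply h zero_le_one, Real.rpow_neg_one]

/-! ### Real weights as vectors of `L²(ℝ)` -/

open Classical in
/-- A real square integrable function as an element of `L²(ℝ)` (`0` if it is not square
integrable). -/
noncomputable def realL2 (w : ℝ → ℝ) : L2R :=
  if h : MemLp (fun ξ => (w ξ : ℂ)) 2 volume then h.toLp _ else 0

theorem realL2_coeFn {w : ℝ → ℝ} (h : MemLp w 2 volume) :
    realL2 w =ᵐ[volume] fun ξ => (w ξ : ℂ) := by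
  have h' : MemLp (fun ξ => (w ξ : ℂ)) 2 volume := h.ofReal
  rw [realL2, dif_pos h']
  exact h'.coeFn_toLp

theorem realL2_sub {v w : ℝ → ℝ} (hv : MemLp v 2 volume) (hw : MemLp w 2 volume) :
    realL2 v - realL2 w = realL2 (fun ξ => v ξ - w ξ) := by
  apply Lp.ext
  filter_upwards [realL2_coeFn hv, realL2_coeFn hw, realL2_coeFn (hv.sub hw),
    Lp.coeFn_sub (realL2 v) (realL2 w)] with x h1 h2 h3 h4
  rw [h4, Pi.sub_apply, h1, h2]
  refine Eq.trans ?_ h3.symm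
  simp

theorem norm_realL2_le {v w : ℝ → ℝ} (hv : MemLp v 2 volume) (hw : MemLp w 2 volume) {c : ℝ}
    (h : ∀ ξ, |v ξ| ≤ c * |w ξ|) : ‖realL2 v‖ ≤ c * ‖realL2 w‖ := by
  apply Lp.norm_le_mul_norm_of_ae_le_mul
  filter_upwards [realL2_coeFn hv, realL2_coeFn hw] with x h1 h2
  rw [h1, h2, Complex.norm_real, Complex.norm_real]
  exact h x

/-- The weight `symb lam ^ α / symb (lam + t)`. -/
noncomputable def resWeight (lam α t ξ : ℝ) : ℝ := symb lam ξ ^ α * (symb (lam + t) ξ)⁻¹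

theorem continuous_resWeight {lam : ℝ} (h : 0 < lam) (α : ℝ) {t : ℝ} (ht : 0 ≤ t) :
    Continuous (resWeight lam α t) :=
  (continuous_symb_rpow h α).mul
    ((continuous_symb _).inv₀ fun ξ => (symb_pos (by linarith) ξ).ne')

theorem resWeight_nonneg {lam : ℝ} (h : 0 < lam) (α : ℝ) {t : ℝ} (ht : 0 ≤ t) (ξ : ℝ) :
    0 ≤ resWeight lam α t ξ :=
  mul_nonneg (Real.rpow_nonneg (symb_pos h ξ).le _)
    (inv_nonneg.2 (symb_pos (by linarith) ξ).le)

theorem resWeight_le {lam : ℝ} (h : 0 < lam) (α : ℝ) {t : ℝ} (ht : 0 ≤ t) (ξ : ℝ) :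
    resWeight lam α t ξ ≤ symb lam ξ ^ (-(1 - α)) := by
  have h0 := symb_pos h ξ
  rw [show -(1 - α) = α + -1 by ring, Real.rpow_add h0, Real.rpow_neg_one]
  unfold resWeight
  rw [symb_add]
  gcongr
  linarith

/-- Both `t` and `symb lam ξ` are at most their sum, so the sum dominates `t ^ θ * symb lam ξ ^ (1 -
θ)`. Decay of order `θ` in `t` is bought with `θ` powers of `symb`. -/
theorem resWeight_le_rpow {lam : ℝ} (h : 0 < lam) (α : ℝ) {t : ℝ} (ht : 0 < t) {θ : ℝ}
    (hθ : θ ∈ Set.Icc 0 1) (ξ : ℝ) :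
    resWeight lam α t ξ ≤ t ^ (-θ) * symb lam ξ ^ (-(1 - α - θ)) := by
  have h0 := symb_pos h ξ
  have h1 : t ^ θ * symb lam ξ ^ (1 - θ) ≤ symb (lam + t) ξ := by
    rw [symb_add]
    calc t ^ θ * symb lam ξ ^ (1 - θ)
        ≤ (symb lam ξ + t) ^ θ * (symb lam ξ + t) ^ (1 - θ) := by
          gcongr
          · exact hθ.1
          · linarith
          · linarith [hθ.2]
          · linarith
      _ = symb lam ξ + t := by
          rw [← Real.rpow_add (by positivity)]; simp
  have h2 : (symb (lam + t) ξ)⁻¹ ≤ (t ^ θ * symb lam ξ ^ (1 - θ))⁻¹ :=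
    inv_anti₀ (by positivity) h1
  calc resWeight lam α t ξ ≤ symb lam ξ ^ α * (t ^ θ * symb lam ξ ^ (1 - θ))⁻¹ := by
        unfold resWeight; gcongr
    _ = t ^ (-θ) * symb lam ξ ^ (-(1 - α - θ)) := by
        rw [mul_inv, ← Real.rpow_neg ht.le, ← Real.rpow_neg h0.le, mul_left_comm,
          ← Real.rpow_add h0]
        congr 2; ring

theorem memLp_resWeight {lam : ℝ} (h : 0 < lam) {α : ℝ} (hα : α < 3 / 4) {t : ℝ} (ht : 0 ≤ t) :
    MemLp (resWeight lam α t) 2 volume := by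
  refine (memLp_symb_rpow h (β := 1 - α) (by linarith)).mono
    (continuous_resWeight h α ht).aestronglyMeasurable (.of_forall fun ξ => ?_)
  rw [Real.norm_of_nonneg (resWeight_nonneg h α ht ξ)]
  exact (resWeight_le h α ht ξ).trans (le_abs_self _)

/-- The scalar resolvent identity gives a Lipschitz bound in `t`, with one of the two resolvent
factors bounded by `lam⁻¹`. -/
theorem continuousOn_realL2_resWeight {lam : ℝ} (h : 0 < lam) {α : ℝ} (hα : α < 3 / 4) :
    ContinuousOn (fun t => realL2 (resWeight lam α t)) (Set.Ioi 0) := by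
  have hv := memLp_symb_rpow h (β := 1 - α) (by linarith)
  refine LipschitzOnWith.continuousOn
    (K := Real.toNNReal (lam⁻¹ * ‖realL2 fun ξ => symb lam ξ ^ (-(1 - α))‖)) ?_
  refine LipschitzOnWith.of_dist_le_mul fun t (ht : 0 < t) s (hs : 0 < s) => ?_
  rw [Real.coe_toNNReal _ (by positivity), dist_eq_norm,
    realL2_sub (memLp_resWeight h hα ht.le) (memLp_resWeight h hα hs.le), mul_right_comm]
  refine norm_realL2_le ((memLp_resWeight h hα ht.le).sub (memLp_resWeight h hα hs.le)) hv
    fun ξ => ?_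
  have h0 := symb_pos h ξ
  have e : resWeight lam α t ξ - resWeight lam α s ξ =
      (symb (lam + t) ξ)⁻¹ * (s - t) * resWeight lam α s ξ := by
    unfold resWeight
    rw [symb_add, symb_add]
    field_simp
    ring
  rw [Pi.sub_apply, e, abs_mul, abs_mul, abs_of_nonneg (resWeight_nonneg h α hs.le ξ), dist_comm,
    Real.dist_eq, abs_of_nonneg (inv_nonneg.2 (symb_pos (by linarith) ξ).le)]
  gcongr
  · exact resWeight_nonneg h α hs.le ξ
  · exact (by linarith : lam ≤ lam + t).trans (le_symb _ _)
  · exact (resWeight_le h α hs.le ξ).trans (le_abs_self _)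

theorem norm_realL2_resWeight_le {lam : ℝ} (h : 0 < lam) {α : ℝ} (hα : α < 3 / 4) {t : ℝ}
    (ht : 0 ≤ t) :
    ‖realL2 (resWeight lam α t)‖ ≤ ‖realL2 fun ξ => symb lam ξ ^ (-(1 - α))‖ := by
  rw [← one_mul ‖realL2 fun ξ => symb lam ξ ^ (-(1 - α))‖]
  refine norm_realL2_le (memLp_resWeight h hα ht) (memLp_symb_rpow h (by linarith)) fun ξ => ?_
  rw [one_mul, abs_of_nonneg (resWeight_nonneg h α ht ξ)]
  exact (resWeight_le h α ht ξ).trans (le_abs_self _)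

theorem norm_realL2_resWeight_le_rpow {lam : ℝ} (h : 0 < lam) {α : ℝ} (hα : α < 3 / 4) {t : ℝ}
    (ht : 0 < t) {θ : ℝ} (hθ : θ ∈ Set.Icc 0 1) (hθα : θ < 3 / 4 - α) :
    ‖realL2 (resWeight lam α t)‖ ≤ t ^ (-θ) * ‖realL2 fun ξ => symb lam ξ ^ (-(1 - α - θ))‖ := by
  refine norm_realL2_le (memLp_resWeight h hα ht.le) (memLp_symb_rpow h (by linarith)) fun ξ => ?_
  rw [abs_of_nonneg (resWeight_nonneg h α ht.le ξ)]
  exact (resWeight_le_rpow h α ht hθ ξ).trans (by gcongr; exact le_abs_self _)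

theorem resWeight_zero (lam t ξ : ℝ) : resWeight lam 0 t ξ = (symb (lam + t) ξ)⁻¹ := by
  simp [resWeight]

/-- This extracts the factor `symb lam ^ (-α)` from the left vector of the rank one term, so that
the difference of resolvents factors through the power of the free one. -/
theorem mulOp_powBcf_realL2_resWeight {lam : ℝ} (h : 0 < lam) {α : ℝ} (h0 : 0 ≤ α)
    (hα : α < 3 / 4) {t : ℝ} (ht : 0 ≤ t) :
    mulOp (powBcf lam α) (realL2 (resWeight lam α t)) = realL2 (resWeight lam 0 t) := by
  apply Lp.ext
  filter_upwards [mulOp_coeFn (powBcf lam α) (realL2 (resWeight lam α t)),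
    realL2_coeFn (memLp_resWeight h hα ht),
    realL2_coeFn (memLp_resWeight h (α := 0) (by norm_num) ht)] with ξ h1 h2 h3
  rw [h1, h2, h3, powBcf_apply h h0, ← Complex.ofReal_mul]
  congr 1
  have := symb_pos h ξ
  rw [resWeight, resWeight, ← mul_assoc, ← Real.rpow_add this]
  simp

/-! ### The resolvents on the Fourier side -/

/-- For large `t` the argument `t⁻¹` is near `0`, and the bound `K` suffices since `p - 2 < -1`. For
small `t` the decay of `E` contributes `t ^ β`, and `p - 2 + β > -1`. -/
theorem integrableOn_rpow_smul_inv {V : Type*} [NormedAddCommGroup V] [NormedSpace ℝ V]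
    {E : ℝ → V} (hE : ContinuousOn E (Set.Ioi 0)) {K L p β : ℝ} (hp : p < 1) (hβ : 1 - p < β)
    (hK : ∀ t, 0 < t → ‖E t‖ ≤ K) (hL : ∀ t, 0 < t → ‖E t‖ ≤ L * t ^ (-β)) :
    IntegrableOn (fun t : ℝ => t ^ (p - 2) • E t⁻¹) (Set.Ioi 0) := by
  have hc : ContinuousOn (fun t : ℝ => t ^ (p - 2) • E t⁻¹) (Set.Ioi 0) := by
    refine ContinuousOn.smul (continuousOn_id.rpow_const fun t ht => .inl (ne_of_gt ht)) ?_
    exact hE.comp (continuousOn_inv₀.mono fun t ht => ne_of_gt ht)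
      fun t ht => Set.mem_Ioi.2 (inv_pos.2 ht)
  rw [← Set.Ioc_union_Ioi_eq_Ioi zero_le_one]
  refine IntegrableOn.union ?_ ?_
  · have hi : IntegrableOn (fun t : ℝ => L * t ^ (p - 2 + β)) (Set.Ioc 0 1) := by
      have := (intervalIntegral.intervalIntegrable_rpow' (a := 0) (b := 1)
        (show -1 < p - 2 + β by linarith)).const_mul L
      rwa [intervalIntegrable_iff_integrableOn_Ioc_of_le zero_le_one] at this
    refine hi.mono' ((hc.mono Set.Ioc_subset_Ioi_self).aestronglyMeasurable measurableSet_Ioc) ?_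
    filter_upwards [ae_restrict_mem measurableSet_Ioc] with t ht
    rw [norm_smul, Real.norm_of_nonneg (Real.rpow_nonneg ht.1.le _), Real.rpow_add ht.1,
      mul_left_comm]
    refine mul_le_mul_of_nonneg_left ?_ (Real.rpow_nonneg ht.1.le _)
    have := hL t⁻¹ (inv_pos.2 ht.1)
    rwa [Real.inv_rpow ht.1.le, Real.rpow_neg ht.1.le, inv_inv] at this
  · have hi : IntegrableOn (fun t : ℝ => K * t ^ (p - 2)) (Set.Ioi 1) :=
      (integrableOn_Ioi_rpow_of_lt (by linarith) one_pos).const_mul K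
    refine hi.mono' ((hc.mono (Set.Ioi_subset_Ioi zero_le_one)).aestronglyMeasurable
      measurableSet_Ioi) ?_
    filter_upwards [ae_restrict_mem measurableSet_Ioi] with t ht
    have ht0 : 0 < t := one_pos.trans ht
    rw [norm_smul, Real.norm_of_nonneg (Real.rpow_nonneg ht0.le _), mul_comm]
    exact mul_le_mul_of_nonneg_right (hK _ (inv_pos.2 ht0)) (Real.rpow_nonneg ht0.le _)

/-- The coefficient of the rank one term in Krein's formula for `(-Δ_γ + lam)⁻¹`. -/
noncomputable def kreinCoef (γ lam : ℝ) : ℝ := γ * (2 * √lam / (2 * √lam - γ))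

/-- The function `1 / symb lam` as an element of `L²(ℝ)`. -/
noncomputable def symbInv (lam : ℝ) : L2R := realL2 fun ξ => (symb lam ξ)⁻¹

/-- The operator `(-Δ_γ + lam)⁻¹` in Fourier variables. -/
noncomputable def fourierRes (γ lam : ℝ) : L2R →L[ℂ] L2R :=
  mulOp (powBcf lam 1) +
    (kreinCoef γ lam : ℂ) • InnerProductSpace.rankOne ℂ (symbInv lam) (symbInv lam)

theorem fourierRes_apply (γ lam : ℝ) (f : L2R) : fourierRes γ lam f =
    mulOp (powBcf lam 1) f + (kreinCoef γ lam : ℂ) • (inner ℂ (symbInv lam) f • symbInv lam) :=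
  rfl

theorem memLp_symb_inv {lam : ℝ} (h : 0 < lam) : MemLp (fun ξ => (symb lam ξ)⁻¹) 2 volume := by
  have := memLp_symb_rpow h (β := 1) (by norm_num)
  simpa only [Real.rpow_neg_one] using this

theorem symbInv_coeFn {lam : ℝ} (h : 0 < lam) :
    symbInv lam =ᵐ[volume] fun ξ => (((symb lam ξ)⁻¹ : ℝ) : ℂ) :=
  realL2_coeFn (memLp_symb_inv h)

theorem symbInv_eq_resWeight (lam t : ℝ) : symbInv (lam + t) = realL2 (resWeight lam 0 t) := by
  simp only [symbInv, funext (resWeight_zero lam t)]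

/-- Divided by `2√lam`, this is `1 + kreinCoef γ lam * ‖e‖²` for `e = symb lam ^ (-1/2)`, the
quantity that decides the sign in `one_add_smul_rankOne_nonneg`. -/
theorem kreinCoef_add_pos {γ lam : ℝ} (h : 0 < lam) (hγ : γ < 2 * √lam) :
    0 < kreinCoef γ lam + 2 * √lam := by
  have h1 : 0 < 2 * √lam - γ := by linarith
  have h2 : 0 < √lam := Real.sqrt_pos.2 h
  have : kreinCoef γ lam + 2 * √lam = (2 * √lam) ^ 2 / (2 * √lam - γ) := by
    unfold kreinCoef
    field_simp
    ring
  rw [this]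
  positivity

/-- The quotient in the coefficient is `1 + γ / (2√(lam + t) - γ)`, whose denominator is smallest at
`t = 0`. -/
theorem abs_kreinCoef_add_le {γ lam : ℝ} (hγ : γ < 2 * √lam) {t : ℝ} (ht : 0 ≤ t) :
    |kreinCoef γ (lam + t)| ≤ |γ| * (1 + |γ| / (2 * √lam - γ)) := by
  have h1 : 0 < 2 * √lam - γ := by linarith
  have h2 : √lam ≤ √(lam + t) := Real.sqrt_le_sqrt (by linarith)
  have h3 : 0 < 2 * √(lam + t) - γ := by linarith
  have h4 : 2 * √(lam + t) / (2 * √(lam + t) - γ) = 1 + γ / (2 * √(lam + t) - γ) := by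
    field_simp; ring
  rw [kreinCoef, abs_mul, h4]
  gcongr
  refine (abs_add_le _ _).trans ?_
  rw [abs_one, abs_div, abs_of_pos h3]
  gcongr

theorem continuousOn_kreinCoef {γ lam : ℝ} (hγ : γ < 2 * √lam) :
    ContinuousOn (fun t => kreinCoef γ (lam + t)) (Set.Ioi 0) := by
  unfold kreinCoef
  refine ContinuousOn.mul continuousOn_const (ContinuousOn.div (by fun_prop) (by fun_prop) ?_)
  intro t (ht : 0 < t)
  have h2 : √lam ≤ √(lam + t) := Real.sqrt_le_sqrt (by linarith)
  exact ne_of_gt (by linarith)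

theorem inner_realL2_self {w : ℝ → ℝ} (hw : MemLp w 2 volume) :
    ‖realL2 w‖ ^ 2 = ∫ ξ, w ξ ^ 2 := by
  have h1 : ((‖realL2 w‖ ^ 2 : ℝ) : ℂ) = ∫ ξ, ((w ξ ^ 2 : ℝ) : ℂ) := by
    have := inner_self_eq_norm_sq_to_K (𝕜 := ℂ) (realL2 w)
    rw [Complex.ofReal_pow]
    refine this.symm.trans ?_
    rw [L2.inner_def]
    apply integral_congr_ae
    filter_upwards [realL2_coeFn hw] with ξ h
    rw [h, RCLike.inner_apply, Complex.conj_ofReal, ← Complex.ofReal_mul, sq]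
  rw [integral_complex_ofReal] at h1
  exact_mod_cast h1

/-- A rank one perturbation `1 + c ⟪e, ·⟫ e` of the identity is nonnegative if `1 + c ‖e‖² ≥ 0`. -/
theorem one_add_smul_rankOne_nonneg {H : Type*} [NormedAddCommGroup H] [InnerProductSpace ℂ H]
    [CompleteSpace H] (e : H) (c : ℝ) (hc : 0 ≤ 1 + c * ‖e‖ ^ 2) :
    0 ≤ (1 : H →L[ℂ] H) + (c : ℂ) • InnerProductSpace.rankOne ℂ e e := by
  have app : ∀ x, ((1 : H →L[ℂ] H) + (c : ℂ) • InnerProductSpace.rankOne ℂ e e) x =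
      x + ((c : ℂ) * inner ℂ e x) • e := fun x => by
    rw [mul_smul]; rfl
  rw [ContinuousLinearMap.nonneg_iff_isPositive, ContinuousLinearMap.isPositive_iff]
  refine ⟨fun x y => ?_, fun x => ?_⟩
  · simp only [ContinuousLinearMap.coe_coe, app, inner_add_left, inner_add_right, inner_smul_left,
      inner_smul_right, map_mul, Complex.conj_ofReal, inner_conj_symm]
    ring
  · have key : inner ℂ (((1 : H →L[ℂ] H) + (c : ℂ) • InnerProductSpace.rankOne ℂ e e) x) x
        = ((‖x‖ ^ 2 + c * ‖inner ℂ e x‖ ^ 2 : ℝ) : ℂ) := by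
      rw [app, inner_add_left, inner_smul_left, inner_self_eq_norm_sq_to_K, map_mul,
        Complex.conj_ofReal, mul_assoc, Complex.conj_mul']
      push_cast
      rfl
    rw [key, Complex.zero_le_real]
    -- Cauchy–Schwarz is needed only for `c ≤ 0`.
    have h1 : ‖inner ℂ e x‖ ^ 2 ≤ ‖e‖ ^ 2 * ‖x‖ ^ 2 := by
      rw [← mul_pow]
      gcongr
      exact norm_inner_le_norm e x
    rcases le_total 0 c with h | h
    · positivity
    · nlinarith [sq_nonneg ‖x‖, mul_le_mul_of_nonpos_left h1 h]

/-- With `M` the square root of the free resolvent and `M e = symbInv lam`, the operator is `M (1 +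
κ ⟪e, ·⟫ e) M`, where `κ = kreinCoef γ lam` and `‖e‖² = 1 / (2√lam)`. A conjugate of a nonnegative
operator is nonnegative. -/
theorem fourierRes_nonneg {γ lam : ℝ} (h : 0 < lam) (hγ : γ < 2 * √lam) :
    0 ≤ fourierRes γ lam := by
  have hmem := memLp_symb_rpow h (β := 1 / 2) (by norm_num)
  set e := realL2 fun ξ => symb lam ξ ^ (-(1 / 2 : ℝ)) with he
  set M := mulOp (powBcf lam (1 / 2)) with hM
  have h0 : 0 ≤ M := mulOp_nonneg (fun ξ => symb lam ξ ^ (-(1 / 2 : ℝ)))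
    (fun ξ => Real.rpow_nonneg (symb_pos h ξ).le _) fun ξ => powBcf_apply h (by norm_num) ξ
  have hsa : star M = M := h0.isSelfAdjoint
  have hnorm : ‖e‖ ^ 2 = (2 * √lam)⁻¹ := by
    rw [he, inner_realL2_self hmem, ← integral_symb_inv h]
    congr 1 with ξ
    rw [← Real.rpow_mul_natCast (symb_pos h ξ).le, ← Real.rpow_neg_one]
    norm_num
  have hMe : M e = symbInv lam := by
    apply Lp.ext
    filter_upwards [mulOp_coeFn (powBcf lam (1 / 2)) e, realL2_coeFn hmem, symbInv_coeFn h]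
      with ξ h1 h2 h3
    rw [h1, h2, h3, powBcf_apply h (by norm_num), ← Complex.ofReal_mul,
      ← Real.rpow_add (symb_pos h ξ), ← Real.rpow_neg_one]
    norm_num
  have hMM : mulOp (powBcf lam 1) = M * M := by
    have : powBcf lam 1 = powBcf lam (1 / 2) * powBcf lam (1 / 2) := by
      ext ξ
      rw [BoundedContinuousFunction.mul_apply, powBcf_apply h (by norm_num),
        powBcf_apply h (by norm_num), ← Complex.ofReal_mul, ← Real.rpow_add (symb_pos h ξ)]
      norm_num
    rw [this]
    exact map_mul mulOpHom _ _
  have key : fourierRes γ lam =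
      star M * (1 + (kreinCoef γ lam : ℂ) • InnerProductSpace.rankOne ℂ e e) * M := by
    ext1 f
    have hin : inner ℂ e (M f) = inner ℂ (symbInv lam) f := by
      rw [← hMe, ← ContinuousLinearMap.adjoint_inner_right, ← ContinuousLinearMap.star_eq_adjoint,
        hsa]
    rw [hsa, fourierRes, hMM]
    change M (M f) + (kreinCoef γ lam : ℂ) • (inner ℂ (symbInv lam) f • symbInv lam) =
      M (M f + (kreinCoef γ lam : ℂ) • (inner ℂ e (M f) • e))
    rw [map_add, map_smul, map_smul, hin, hMe]
  rw [key]
  refine star_left_conjugate_nonneg (one_add_smul_rankOne_nonneg e _ ?_) M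
  have h2 : 0 < √lam := Real.sqrt_pos.2 h
  have h3 := kreinCoef_add_pos h hγ
  rw [hnorm]
  have : 1 + kreinCoef γ lam * (2 * √lam)⁻¹ = (kreinCoef γ lam + 2 * √lam) * (2 * √lam)⁻¹ := by
    field_simp; ring
  rw [this]
  positivity

/-! ### The rank one difference of the perturbed and free resolvents -/

open InnerProductSpace in
theorem isCompactOperator_smul_rankOne {H : Type*} [NormedAddCommGroup H] [InnerProductSpace ℂ H]
    (c : ℂ) (x y : H) : IsCompactOperator (c • rankOne ℂ x y : H →L[ℂ] H) := by
  have h : IsCompactOperator (ContinuousLinearMap.toSpanSingleton ℂ x) :=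
    isCompactOperator_of_locallyCompactSpace_rng (ContinuousLinearMap.toSpanSingleton ℂ x)
  exact (h.comp_clm (innerSL ℂ y)).smul c

open InnerProductSpace in
theorem continuousOn_smul_rankOne {H : Type*} [NormedAddCommGroup H] [InnerProductSpace ℂ H]
    {c : ℝ → ℂ} {x y : ℝ → H} {s : Set ℝ} (hc : ContinuousOn c s) (hx : ContinuousOn x s)
    (hy : ContinuousOn y s) :
    ContinuousOn (fun t => (c t • rankOne ℂ (x t) (y t) : H →L[ℂ] H)) s := by
  have h1 : ContinuousOn (fun t => ContinuousLinearMap.smulRightL ℂ ℂ H (1 : ℂ →L[ℂ] ℂ) (x t)) s :=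
    (ContinuousLinearMap.smulRightL ℂ ℂ H (1 : ℂ →L[ℂ] ℂ)).continuous.comp_continuousOn hx
  have h2 : ContinuousOn (fun t => innerSL ℂ (y t)) s :=
    (innerSL ℂ (E := H)).continuous.comp_continuousOn hy
  refine hc.smul ((h1.clm_comp h2).congr fun t _ => ?_)
  ext z
  rfl

/-- The rank one operators through which the perturbed and the free resolvent differ, up to
the factor `mulOp (powBcf lam α)`. -/
noncomputable def resDiff (γ lam α t : ℝ) : L2R →L[ℂ] L2R := (kreinCoef γ (lam + t) : ℂ) •
  InnerProductSpace.rankOne ℂ (realL2 (resWeight lam α t)) (realL2 (resWeight lam 0 t))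

theorem norm_resDiff_le {γ lam : ℝ} (hγ : γ < 2 * √lam) (α : ℝ) {t : ℝ} (ht : 0 < t) :
    ‖resDiff γ lam α t‖ ≤ |γ| * (1 + |γ| / (2 * √lam - γ)) *
      (‖realL2 (resWeight lam α t)‖ * ‖realL2 (resWeight lam 0 t)‖) := by
  rw [resDiff, norm_smul, InnerProductSpace.norm_rankOne, Complex.norm_real]
  gcongr
  exact abs_kreinCoef_add_le hγ ht.le

theorem continuousOn_resDiff {γ lam : ℝ} (h : 0 < lam) (hγ : γ < 2 * √lam) {α : ℝ}
    (hα : α < 3 / 4) : ContinuousOn (resDiff γ lam α) (Set.Ioi 0) := by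
  exact continuousOn_smul_rankOne
    (Complex.continuous_ofReal.comp_continuousOn (continuousOn_kreinCoef hγ))
    (continuousOn_realL2_resWeight h hα) (continuousOn_realL2_resWeight h (by norm_num))

theorem integrableOn_rpow_smul_resDiff {γ lam : ℝ} (h : 0 < lam) (hγ : γ < 2 * √lam) {α : ℝ}
    (h0 : 0 < α) (hα : α < 3 / 4) :
    IntegrableOn (fun t : ℝ => t ^ (α - 2) • resDiff γ lam α t⁻¹) (Set.Ioi 0) := by
  have hγ0 : 0 < 2 * √lam - γ := by linarith
  -- The left vector decays with any exponent below `3/4 - α`, the right one with any below `3/4`.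
  -- The choices `(3/4 - α) / 2` and `5/8` add up to `1 - α / 2`, which exceeds the required `1 -
  -- α`.
  refine integrableOn_rpow_smul_inv (β := (3 / 4 - α) / 2 + 5 / 8)
    (K := |γ| * (1 + |γ| / (2 * √lam - γ)) *
      (‖realL2 fun ξ => symb lam ξ ^ (-(1 - α))‖ * ‖realL2 fun ξ => symb lam ξ ^ (-(1 - 0 : ℝ))‖))
    (L := |γ| * (1 + |γ| / (2 * √lam - γ)) *
      (‖realL2 fun ξ => symb lam ξ ^ (-(1 - α - (3 / 4 - α) / 2))‖ *
        ‖realL2 fun ξ => symb lam ξ ^ (-(1 - 0 - 5 / 8 : ℝ))‖))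
    (continuousOn_resDiff h hγ hα) (by linarith) (by linarith) ?_ ?_
  · intro t ht
    refine (norm_resDiff_le hγ α ht).trans ?_
    gcongr
    · exact norm_realL2_resWeight_le h hα ht.le
    · exact norm_realL2_resWeight_le h (by norm_num) ht.le
  · intro t ht
    refine (norm_resDiff_le hγ α ht).trans ?_
    have h1 := norm_realL2_resWeight_le_rpow h hα ht (θ := (3 / 4 - α) / 2)
      ⟨by linarith, by linarith⟩ (by linarith)
    have h2 := norm_realL2_resWeight_le_rpow h (α := 0) (by norm_num) ht (θ := 5 / 8)
      ⟨by norm_num, by norm_num⟩ (by norm_num)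
    have h3 := mul_le_mul h1 h2 (norm_nonneg _) (by positivity)
    refine (mul_le_mul_of_nonneg_left h3 (by positivity)).trans_eq ?_
    rw [neg_add, Real.rpow_add ht]
    ring

theorem fourierRes_sub_mulOp {γ lam : ℝ} (h : 0 < lam) {α : ℝ} (h0 : 0 ≤ α) (hα : α < 3 / 4)
    {t : ℝ} (ht : 0 ≤ t) : fourierRes γ (lam + t) - mulOp (powBcf (lam + t) 1) =
      mulOp (powBcf lam α) ∘L resDiff γ lam α t := by
  ext1 f
  change (fourierRes γ (lam + t) f - mulOp (powBcf (lam + t) 1) f) = mulOp (powBcf lam α)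
    ((kreinCoef γ (lam + t) : ℂ) •
      (inner ℂ (realL2 (resWeight lam 0 t)) f • realL2 (resWeight lam α t)))
  rw [map_smul, map_smul, mulOp_powBcf_realL2_resWeight h h0 hα ht, fourierRes_apply,
    symbInv_eq_resWeight, add_sub_cancel_left]

theorem mulOp_powBcf_one_nonneg {lam : ℝ} (h : 0 < lam) : 0 ≤ mulOp (powBcf lam 1) :=
  mulOp_nonneg (fun ξ => (symb lam ξ)⁻¹) (fun ξ => inv_nonneg.2 (symb_pos h ξ).le)
    (powBcf_one_apply h)

theorem opPow_mulOp_powBcf_one {lam : ℝ} (h : 0 < lam) {α : ℝ} (h0 : 0 ≤ α) :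
    opPow (mulOp (powBcf lam 1)) α = mulOp (powBcf lam α) :=
  map_bcf_rpow mulOpHom continuous_mulOpHom h0 (fun ξ => (symb lam ξ)⁻¹) (powBcf_one_apply h)
    (fun ξ => by
      rw [powBcf_apply h h0, Real.inv_rpow (symb_pos h ξ).le, Real.rpow_neg (symb_pos h ξ).le])
    (mulOp_powBcf_one_nonneg h)

theorem mulOp_powBcf_resolvent {lam : ℝ} (h : 0 < lam) {t : ℝ} (ht : 0 < t) :
    mulOp (powBcf (lam + t) 1) * (1 + t • mulOp (powBcf lam 1)) = mulOp (powBcf lam 1) := by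
  have h3 : powBcf (lam + t) 1 * (1 + (t : ℂ) • powBcf lam 1) = powBcf lam 1 := by
    ext ξ
    have h1 := symb_pos h ξ
    have h2 : symb lam ξ + t ≠ 0 := by positivity
    rw [BoundedContinuousFunction.mul_apply, BoundedContinuousFunction.add_apply,
      BoundedContinuousFunction.smul_apply, BoundedContinuousFunction.coe_one, Pi.one_apply,
      powBcf_one_apply h, powBcf_one_apply (by linarith : 0 < lam + t), symb_add, smul_eq_mul]
    norm_cast
    field_simp
  have h4 := congrArg mulOpHom h3
  rw [map_mul, map_add, map_one, map_smul] at h4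
  exact h4

/-- If the operators `fourierRes γ (lam + t)` satisfy the resolvent identity, then the powers of
`fourierRes γ lam` and of the free resolvent agree up to an invertible right factor. -/
theorem exists_equiv_fourierRes_rpow {γ lam : ℝ} (h : 0 < lam) (hγ : γ < 2 * √lam)
    (hinj : ∀ y, fourierRes γ lam y = 0 → y = 0)
    (hres : ∀ t, 0 < t → fourierRes γ (lam + t) * (1 + t • fourierRes γ lam) = fourierRes γ lam)
    {α : ℝ} (h0 : 0 < α) (hα : α < 3 / 4) :
    ∃ A : L2R ≃L[ℂ] L2R,
      opPow (fourierRes γ lam) α = (mulOp (powBcf lam α)) ∘L (A : L2R →L[ℂ] L2R) := by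
  rw [← opPow_mulOp_powBcf_one h h0.le]
  refine exists_equiv_rpow_eq_comp (X := fun t => fourierRes γ (lam + t))
    (Y := fun t => mulOp (powBcf (lam + t) 1)) (E := resDiff γ lam α) (fourierRes_nonneg h hγ)
    (mulOp_powBcf_one_nonneg h) hinj ⟨h0, by linarith⟩ hres
    (fun t ht => mulOp_powBcf_resolvent h ht) (fun t ht => ?_)
    (fun t => isCompactOperator_smul_rankOne _ _ _) (integrableOn_rpow_smul_resDiff h hγ h0 hα)
  exact (fourierRes_sub_mulOp h h0.le hα ht.le).trans
    (congrArg (· ∘L resDiff γ lam α t) (opPow_mulOp_powBcf_one h h0.le).symm)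

end DeltaPotential

namespace DeltaPotential

open SchwartzMap

/-! ### Fourier transforms of square integrable functions -/

theorem integral_fourier_mul (ψ : 𝓢(ℝ, ℂ)) (f : L2R) :
    ∫ x, (𝓕 ψ : 𝓢(ℝ, ℂ)) x * f x = ∫ ξ, ψ ξ * (𝓕 f : L2R) ξ := by
  have h := congrArg (fun T : TemperedDistribution ℝ ℂ => T ψ)
    (Lp.fourier_toTemperedDistribution_eq f)
  simpa [TemperedDistribution.fourier_apply] using h

theorem integral_fourierInv_mul (ψ : 𝓢(ℝ, ℂ)) (f : L2R) :
    ∫ x, (𝓕⁻ ψ : 𝓢(ℝ, ℂ)) x * f x = ∫ ξ, ψ ξ * (𝓕⁻ f : L2R) ξ := by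
  have h := congrArg (fun T : TemperedDistribution ℝ ℂ => T ψ)
    (Lp.fourierInv_toTemperedDistribution_eq f)
  simpa [TemperedDistribution.fourierInv_apply] using h

theorem ae_eq_of_integral_schwartz_mul_eq {h k : ℝ → ℂ} (hh : LocallyIntegrable h)
    (hk : LocallyIntegrable k) (H : ∀ ψ : 𝓢(ℝ, ℂ), ∫ x, ψ x * h x = ∫ x, ψ x * k x) :
    h =ᵐ[volume] k := by
  refine ae_eq_of_integral_contDiff_smul_eq hh hk fun φ hφ hc => ?_
  have hc1 : HasCompactSupport (Complex.ofRealCLM ∘ φ) := hc.comp_left rfl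
  have hφ1 : ContDiff ℝ ∞ (Complex.ofRealCLM ∘ φ) := by fun_prop
  simpa using H (hc1.toSchwartzMap hφ1)

theorem L2R.locallyIntegrable (f : L2R) : LocallyIntegrable f :=
  (Lp.memLp f).locallyIntegrable (by norm_num)

theorem continuous_fourierInv_of_integrable {k : ℝ → ℂ} (hk : Integrable k) :
    Continuous (𝓕⁻ k) := by
  have := VectorFourier.fourierIntegral_continuous Real.continuous_fourierChar
    (L := -innerₗ ℝ) (by simpa using! continuous_inner.neg) hk
  exact this

theorem continuous_fourier_of_integrable {k : ℝ → ℂ} (hk : Integrable k) :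
    Continuous (𝓕 k) :=
  VectorFourier.fourierIntegral_continuous Real.continuous_fourierChar
    (L := innerₗ ℝ) (by simpa using! continuous_inner) hk

/-- The `L²` transform and the integral agree when tested against Schwartz functions. This yields a
continuous representative, so that point values such as `f(0)` become integrals of the transform. -/
theorem fourierInv_coeFn_of_integrable {k : L2R} (hk : Integrable k) :
    (𝓕⁻ k : L2R) =ᵐ[volume] 𝓕⁻ (k : ℝ → ℂ) := by
  refine ae_eq_of_integral_schwartz_mul_eq (L2R.locallyIntegrable _)
    (continuous_fourierInv_of_integrable hk).locallyIntegrable fun ψ => ?_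
  rw [← integral_fourierInv_mul, SchwartzMap.fourierInv_coe]
  have := VectorFourier.integral_fourierIntegral_smul_eq_flip (L := -innerₗ ℝ) (μ := volume)
    (ν := volume) Real.continuous_fourierChar (by simpa using! continuous_inner.neg) ψ.integrable hk
  have e : (-innerₗ ℝ : ℝ →ₗ[ℝ] ℝ →ₗ[ℝ] ℝ).flip = -innerₗ ℝ := by ext; simp
  rw [e] at this
  exact this

theorem fourier_coeFn_of_integrable {k : L2R} (hk : Integrable k) :
    (𝓕 k : L2R) =ᵐ[volume] 𝓕 (k : ℝ → ℂ) := by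
  refine ae_eq_of_integral_schwartz_mul_eq (L2R.locallyIntegrable _)
    (continuous_fourier_of_integrable hk).locallyIntegrable fun ψ => ?_
  rw [← integral_fourier_mul, SchwartzMap.fourier_coe]
  have := VectorFourier.integral_fourierIntegral_smul_eq_flip (L := innerₗ ℝ) (μ := volume)
    (ν := volume) Real.continuous_fourierChar (by simpa using! continuous_inner) ψ.integrable hk
  have e : (innerₗ ℝ : ℝ →ₗ[ℝ] ℝ →ₗ[ℝ] ℝ).flip = innerₗ ℝ := by ext; simp
  rw [e] at this
  exact this

/-- The Fourier symbol of differentiation acting on Schwartz functions. -/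
noncomputable def mulSymb (ψ : 𝓢(ℝ, ℂ)) : 𝓢(ℝ, ℂ) :=
  (-(2 * Real.pi * Complex.I)) • smulLeftCLM ℂ (fun x : ℝ => (x : ℂ)) ψ

theorem mulSymb_apply (ψ : 𝓢(ℝ, ℂ)) (x : ℝ) :
    mulSymb ψ x = -(2 * Real.pi * Complex.I) * x * ψ x := by
  have : Function.HasTemperateGrowth fun x : ℝ => (x : ℂ) :=
    Complex.ofRealCLM.hasTemperateGrowth
  simp [mulSymb, smulLeftCLM_apply_apply this]
  ring

theorem deriv_fourier_schwartz (ψ : 𝓢(ℝ, ℂ)) (x : ℝ) :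
    deriv (𝓕 ψ : 𝓢(ℝ, ℂ)) x = (𝓕 (mulSymb ψ) : 𝓢(ℝ, ℂ)) x := by
  rw [SchwartzMap.fourier_coe, SchwartzMap.fourier_coe, Real.deriv_fourier ψ.integrable]
  · refine congrFun (congrArg 𝓕 (funext fun ξ => ?_)) x
    rw [mulSymb_apply, smul_eq_mul]
    ring
  · have := (smulLeftCLM ℂ (fun x : ℝ => (x : ℝ)) ψ).integrable (μ := volume)
    refine this.congr (.of_forall fun ξ => ?_)
    have h : Function.HasTemperateGrowth fun x : ℝ => (x : ℝ) :=
      (ContinuousLinearMap.id ℝ ℝ).hasTemperateGrowth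
    exact smulLeftCLM_apply_apply h ψ ξ

theorem fourier_schwartz_zero (ψ : 𝓢(ℝ, ℂ)) : (𝓕 ψ : 𝓢(ℝ, ℂ)) 0 = ∫ x, ψ x := by
  rw [SchwartzMap.fourier_coe, Real.fourier_eq]
  simp

theorem integrable_schwartz_mul (ψ : 𝓢(ℝ, ℂ)) (f : L2R) : Integrable fun x => ψ x * f x :=
  MemLp.integrable_mul (ψ.memLp 2) (Lp.memLp f)

/-- The relation `∫ (mulSymb ψ) h = ∫ ψ k` for all `ψ` means that `k = -2πi ξ h`. -/
theorem ae_eq_of_integral_mulSymb_mul_eq {h : L2R} {k : ℝ → ℂ} (hk : LocallyIntegrable k)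
    (H : ∀ ψ : 𝓢(ℝ, ℂ), ∫ ξ, mulSymb ψ ξ * h ξ = ∫ ξ, ψ ξ * k ξ) :
    (fun ξ : ℝ => -(2 * Real.pi * Complex.I) * ξ * h ξ) =ᵐ[volume] k := by
  refine ae_eq_of_integral_schwartz_mul_eq ?_ hk fun ψ => ?_
  · have hc : Continuous fun ξ : ℝ => -(2 * Real.pi * Complex.I) * (ξ : ℂ) := by fun_prop
    have := (L2R.locallyIntegrable h).locallyIntegrableOn Set.univ |>.continuousOn_mul
      hc.continuousOn isOpen_univ.isLocallyClosed
    simpa [locallyIntegrableOn_univ] using this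
  · rw [← H ψ]
    congr 1 with ξ
    rw [mulSymb_apply]
    ring

end DeltaPotential

namespace DeltaPotential

open SchwartzMap

/-! ### Weak derivatives tested on complex and on Schwartz functions -/

theorem integrable_mul_L2 {φ : ℝ → ℂ} (h : Continuous φ) (hc : HasCompactSupport φ) (f : L2R) :
    Integrable fun x => φ x * f x := by
  have := (L2R.locallyIntegrable f).integrable_smul_left_of_hasCompactSupport h hc
  exact this

/-- Weak derivatives are defined with real test functions; the real and imaginary parts of `φ` are
tested separately. -/
theorem HasWeakDerivOn.integral_deriv_mul {Ω : Set ℝ} {f g : L2R} (h : HasWeakDerivOn Ω f g)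
    {φ : ℝ → ℂ} (hφ : ContDiff ℝ ∞ φ) (hc : HasCompactSupport φ) (hs : tsupport φ ⊆ Ω) :
    ∫ x, deriv φ x * f x = -∫ x, φ x * g x := by
  have hd : Differentiable ℝ φ := hφ.differentiable (by norm_num)
  have hre : ContDiff ℝ ∞ fun x => (φ x).re := Complex.reCLM.contDiff.comp hφ
  have him : ContDiff ℝ ∞ fun x => (φ x).im := Complex.imCLM.contDiff.comp hφ
  have hcre : HasCompactSupport fun x => (φ x).re := hc.comp_left (g := Complex.re) rfl
  have hcim : HasCompactSupport fun x => (φ x).im := hc.comp_left (g := Complex.im) rfl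
  have hsre : tsupport (fun x => (φ x).re) ⊆ Ω :=
    (closure_mono (Function.support_comp_subset (g := Complex.re) rfl φ)).trans hs
  have hsim : tsupport (fun x => (φ x).im) ⊆ Ω :=
    (closure_mono (Function.support_comp_subset (g := Complex.im) rfl φ)).trans hs
  have dre : ∀ x, deriv (fun x => (φ x).re) x = (deriv φ x).re := fun x =>
    (Complex.reCLM.hasFDerivAt.comp_hasDerivAt x (hd x).hasDerivAt).deriv
  have dim : ∀ x, deriv (fun x => (φ x).im) x = (deriv φ x).im := fun x =>
    (Complex.imCLM.hasFDerivAt.comp_hasDerivAt x (hd x).hasDerivAt).deriv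
  have h1 := h _ hre hcre hsre
  have h2 := h _ him hcim hsim
  simp only [dre, dim] at h1 h2
  have i1 := integrable_smul_L2 (hre.continuous_deriv (by norm_num)) hcre.deriv f
  have i2 := integrable_smul_L2 (him.continuous_deriv (by norm_num)) hcim.deriv f
  have i3 := integrable_smul_L2 hre.continuous hcre g
  have i4 := integrable_smul_L2 him.continuous hcim g
  simp only [dre, dim] at i1 i2
  have e1 : ∀ x, deriv φ x * f x =
      (deriv φ x).re • f x + Complex.I * ((deriv φ x).im • f x) := fun x => by
    conv_lhs => rw [← Complex.re_add_im (deriv φ x)]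
    simp only [Complex.real_smul]; ring
  have e2 : ∀ x, φ x * g x = (φ x).re • g x + Complex.I * ((φ x).im • g x) := fun x => by
    conv_lhs => rw [← Complex.re_add_im (φ x)]
    simp only [Complex.real_smul]; ring
  simp_rw [e1, e2]
  rw [integral_add i1 (i2.const_mul _), integral_add i3 (i4.const_mul _), integral_const_mul,
    integral_const_mul, h1, h2]
  ring

/-- A smooth cutoff function which is `1` on `[-1, 1]` and vanishes outside `(-2, 2)`. -/
noncomputable def cutoff : ContDiffBump (0 : ℝ) := ⟨1, 2, one_pos, one_lt_two⟩

theorem cutoff_eq_one {x : ℝ} (h : |x| ≤ 1) : cutoff x = 1 :=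
  cutoff.one_of_mem_closedBall (by simpa [cutoff] using h)

theorem cutoff_eq_zero {x : ℝ} (h : 2 ≤ |x|) : cutoff x = 0 :=
  cutoff.zero_of_le_dist (by simpa [cutoff] using h)

theorem contDiff_cutoff : ContDiff ℝ ∞ cutoff := cutoff.contDiff

theorem abs_cutoff_le (x : ℝ) : |cutoff x| ≤ 1 := by
  rw [abs_of_nonneg cutoff.nonneg]; exact cutoff.le_one

theorem continuous_deriv_cutoff : Continuous (deriv cutoff) :=
  contDiff_cutoff.continuous_deriv (by norm_num)

theorem hasCompactSupport_deriv_cutoff : HasCompactSupport (deriv cutoff) :=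
  cutoff.hasCompactSupport.deriv

theorem exists_abs_deriv_cutoff_le : ∃ K, ∀ x, |deriv cutoff x| ≤ K :=
  hasCompactSupport_deriv_cutoff.exists_bound_of_continuous continuous_deriv_cutoff

theorem hasDerivAt_cutoff_mul (c x : ℝ) :
    HasDerivAt (fun x => cutoff (c * x)) (c * deriv cutoff (c * x)) x := by
  have h1 : HasDerivAt cutoff (deriv cutoff (c * x)) (c * x) :=
    (contDiff_cutoff.differentiable (by norm_num) _).hasDerivAt
  have h2 : HasDerivAt (fun x : ℝ => c * x) c x := by simpa using (hasDerivAt_id x).const_mul c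
  rw [mul_comm]
  exact h1.comp x h2

theorem deriv_cutoff_eq_zero {x : ℝ} (h : 2 < |x|) : deriv cutoff x = 0 := by
  have : cutoff =ᶠ[𝓝 x] fun _ => (0 : ℝ) := by
    filter_upwards [continuous_abs.continuousAt.eventually (lt_mem_nhds h)] with y hy
    exact cutoff_eq_zero hy.le
  rw [this.deriv_eq, deriv_const]

/-- An integration by parts formula extends from compactly supported to Schwartz functions. -/
theorem integral_deriv_mul_schwartz {f g : L2R} {c : ℂ}
    (H : ∀ φ : ℝ → ℂ, ContDiff ℝ ∞ φ → HasCompactSupport φ →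
      ∫ x, deriv φ x * f x = -(∫ x, φ x * g x) + c * φ 0) (φ : 𝓢(ℝ, ℂ)) :
    ∫ x, deriv φ x * f x = -(∫ x, φ x * g x) + c * φ 0 := by
  obtain ⟨K, hK⟩ := exists_abs_deriv_cutoff_le
  have hφd : ∀ x, HasDerivAt φ (deriv φ x) x := fun x => (φ.differentiable x).hasDerivAt
  set r : ℕ → ℝ := fun n => ((n : ℝ) + 1)⁻¹ with hr
  have hr0 : ∀ n, 0 < r n := fun n => by positivity
  have hr1 : ∀ n, r n ≤ 1 := fun n => inv_le_one_of_one_le₀ (by linarith [n.cast_nonneg (α := ℝ)])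
  have hrl : Tendsto r atTop (𝓝 0) := by
    simpa [hr, one_div] using tendsto_one_div_add_atTop_nhds_zero_nat (𝕜 := ℝ)
  have hcl : ∀ x : ℝ, Tendsto (fun n => ((cutoff (r n * x) : ℝ) : ℂ)) atTop (𝓝 1) := fun x => by
    have h1 : Tendsto (fun n => r n * x) atTop (𝓝 0) := by simpa using hrl.mul_const x
    have h2 := (contDiff_cutoff.continuous.tendsto 0).comp h1
    rw [cutoff_eq_one (by simp)] at h2
    exact_mod_cast (Complex.continuous_ofReal.tendsto 1).comp h2
  -- Truncation at scale `n + 1`: the extra term in the derivative is of size `r n`, and the value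
  -- at `0` is unchanged, so the point term passes through the limit.
  set Φ : ℕ → ℝ → ℂ := fun n x => φ x * cutoff (r n * x) with hΦ
  have hsm : ∀ n, ContDiff ℝ ∞ (Φ n) := fun n =>
    (φ.smooth ⊤).mul (Complex.ofRealCLM.contDiff.comp
      (contDiff_cutoff.comp (contDiff_const.mul contDiff_id)))
  have hcs : ∀ n, HasCompactSupport (Φ n) := fun n => by
    refine HasCompactSupport.intro (isCompact_Icc (a := -(2 / r n)) (b := 2 / r n)) fun x hx => ?_
    have : 2 ≤ |r n * x| := by
      rw [abs_mul, abs_of_pos (hr0 n), mul_comm, ← div_le_iff₀ (hr0 n)]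
      by_contra h
      exact hx (abs_le.1 (not_le.1 h).le)
    simp [hΦ, cutoff_eq_zero this]
  have hder : ∀ n x, deriv (Φ n) x = deriv φ x * cutoff (r n * x) +
      φ x * ((r n * deriv cutoff (r n * x) : ℝ) : ℂ) := fun n x =>
    ((hφd x).mul (hasDerivAt_cutoff_mul (r n) x).ofReal_comp).deriv
  have if1 := integrable_schwartz_mul (derivCLM ℂ ℂ φ) f
  have if2 := integrable_schwartz_mul φ f
  have ig := integrable_schwartz_mul φ g
  simp only [derivCLM_apply] at if1
  have L1 : Tendsto (fun n => ∫ x, deriv (Φ n) x * f x) atTop (𝓝 (∫ x, deriv φ x * f x)) := by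
    refine tendsto_integral_of_dominated_convergence
      (fun x => ‖deriv φ x * f x‖ + K * ‖φ x * f x‖) (fun n => ?_) (if1.norm.add
        (if2.norm.const_mul K)) (fun n => .of_forall fun x => ?_) (.of_forall fun x => ?_)
    · exact ((hsm n).continuous_deriv (by norm_num)).aestronglyMeasurable.mul
        (Lp.aestronglyMeasurable f)
    · rw [hder, add_mul]
      refine (norm_add_le _ _).trans (add_le_add ?_ ?_)
      · rw [norm_mul, norm_mul, norm_mul, Complex.norm_real]
        gcongr
        exact mul_le_of_le_one_right (norm_nonneg _) (abs_cutoff_le _)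
      · have h3 : ‖((r n * deriv cutoff (r n * x) : ℝ) : ℂ)‖ ≤ K := by
          rw [Complex.norm_real, norm_mul, Real.norm_of_nonneg (hr0 n).le]
          calc r n * ‖deriv cutoff (r n * x)‖ ≤ 1 * ‖deriv cutoff (r n * x)‖ := by
                gcongr; exact hr1 n
            _ ≤ K := by rw [one_mul]; exact hK _
        calc ‖φ x * ((r n * deriv cutoff (r n * x) : ℝ) : ℂ) * f x‖
            = ‖((r n * deriv cutoff (r n * x) : ℝ) : ℂ)‖ * ‖φ x * f x‖ := by
              simp only [norm_mul]; ring
          _ ≤ K * ‖φ x * f x‖ := by gcongr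
    · simp only [hder]
      have h4 : Tendsto (fun n => ((r n * deriv cutoff (r n * x) : ℝ) : ℂ)) atTop (𝓝 0) := by
        have h5 : Tendsto (fun n => r n * deriv cutoff (r n * x)) atTop (𝓝 0) := by
          refine squeeze_zero_norm (a := fun n => r n * K) (fun n => ?_)
            (by simpa using hrl.mul_const K)
          rw [norm_mul, Real.norm_of_nonneg (hr0 n).le]
          exact mul_le_mul_of_nonneg_left (hK _) (hr0 n).le
        exact_mod_cast (Complex.continuous_ofReal.tendsto 0).comp h5
      simpa using (((hcl x).const_mul (deriv φ x)).add (h4.const_mul (φ x))).mul_const (f x)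
  have L2 : Tendsto (fun n => ∫ x, Φ n x * g x) atTop (𝓝 (∫ x, φ x * g x)) := by
    refine tendsto_integral_of_dominated_convergence (fun x => ‖φ x * g x‖) (fun n => ?_) ig.norm
      (fun n => .of_forall fun x => ?_) (.of_forall fun x => ?_)
    · exact (hsm n).continuous.aestronglyMeasurable.mul (Lp.aestronglyMeasurable g)
    · rw [hΦ, norm_mul, norm_mul, norm_mul, Complex.norm_real]
      gcongr
      exact mul_le_of_le_one_right (norm_nonneg _) (abs_cutoff_le _)
    · simpa using ((hcl x).const_mul (φ x)).mul_const (g x)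
  have L3 : ∀ n, Φ n 0 = φ 0 := fun n => by simp [hΦ, cutoff_eq_one]
  refine tendsto_nhds_unique L1 ?_
  have := L2.neg.add_const (c * φ 0)
  refine this.congr fun n => ?_
  rw [H (Φ n) (hsm n) (hcs n), L3]

theorem integral_deriv_cutoff_Ioi : ∫ x in Set.Ioi 0, deriv cutoff x = -1 := by
  have h := integral_Ioi_of_hasDerivAt_of_tendsto (f := cutoff) (f' := deriv cutoff) (a := 0)
    (m := 0) contDiff_cutoff.continuous.continuousWithinAt
    (fun x _ => (contDiff_cutoff.differentiable (by norm_num) _).hasDerivAt)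
    (continuous_deriv_cutoff.integrable_of_hasCompactSupport
      hasCompactSupport_deriv_cutoff).integrableOn
    (tendsto_const_nhds.congr' (by
      filter_upwards [eventually_ge_atTop 2] with x hx
      exact (cutoff_eq_zero (hx.trans (le_abs_self x))).symm))
  rw [h, cutoff_eq_one (by simp), zero_sub]

theorem integral_deriv_cutoff_Iic : ∫ x in Set.Iic 0, deriv cutoff x = 1 := by
  have h := integral_Iic_of_hasDerivAt_of_tendsto (f := cutoff) (f' := deriv cutoff) (a := 0)
    (m := 0) contDiff_cutoff.continuous.continuousWithinAt
    (fun x _ => (contDiff_cutoff.differentiable (by norm_num) _).hasDerivAt)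
    (continuous_deriv_cutoff.integrable_of_hasCompactSupport
      hasCompactSupport_deriv_cutoff).integrableOn
    (tendsto_const_nhds.congr' (by
      filter_upwards [eventually_le_atBot (-2)] with x hx
      exact (cutoff_eq_zero (by rw [abs_of_nonpos (by linarith)]; linarith)).symm))
  rw [h, cutoff_eq_one (by simp), sub_zero]

/-- Concentrating the derivative of the cutoff at `0` produces the jump. -/
theorem tendsto_integral_deriv_cutoff {φ G : ℝ → ℂ} {a b : ℂ} (hφ : Continuous φ)
    (hG : ContinuousOn G {0}ᶜ) (ha : Tendsto G (𝓝[>] 0) (𝓝 a)) (hb : Tendsto G (𝓝[<] 0) (𝓝 b))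
    {r : ℕ → ℝ} (hr : ∀ n, 0 < r n) (hrl : Tendsto r atTop (𝓝 0)) :
    Tendsto (fun n => ∫ x, φ x * (((r n)⁻¹ * deriv cutoff ((r n)⁻¹ * x) : ℝ) : ℂ) * G x) atTop
      (𝓝 (φ 0 * (b - a))) := by
  set J : ℝ → ℂ := fun x => if 0 < x then a else b with hJ
  -- After rescaling `x = r n * y` the factor `deriv cutoff` is fixed, while `G (r n * y)` tends to
  -- `a` or `b` according to the sign of `y`.
  have hsubst : ∀ n, ∫ x, φ x * (((r n)⁻¹ * deriv cutoff ((r n)⁻¹ * x) : ℝ) : ℂ) * G x =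
      ∫ y, φ (r n * y) * ((deriv cutoff y : ℝ) : ℂ) * G (r n * y) := fun n => by
    have h1 := Measure.integral_comp_mul_left (fun x : ℝ => φ x *
      (((r n)⁻¹ * deriv cutoff ((r n)⁻¹ * x) : ℝ) : ℂ) * G x) (r n)
    have hne := (hr n).ne'
    rw [abs_of_pos (inv_pos.2 (hr n)), eq_inv_smul_iff₀ hne, ← integral_smul] at h1
    rw [← h1]
    congr 1 with y
    rw [inv_mul_cancel_left₀ hne, Complex.real_smul]
    push_cast
    have : ((r n : ℝ) : ℂ) ≠ 0 := by exact_mod_cast hne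
    field_simp
  simp_rw [hsubst]
  have hlim : ∫ y, φ 0 * ((deriv cutoff y : ℝ) : ℂ) * J y = φ 0 * (b - a) := by
    have hi : Integrable fun y => ((deriv cutoff y : ℝ) : ℂ) :=
      (continuous_deriv_cutoff.integrable_of_hasCompactSupport
        hasCompactSupport_deriv_cutoff).ofReal
    have e1 : Set.EqOn (fun y => φ 0 * ((deriv cutoff y : ℝ) : ℂ) * J y)
        (fun y => (φ 0 * a) * ((deriv cutoff y : ℝ) : ℂ)) (Set.Ioi 0) := fun y hy => by
      simp only [hJ, if_pos (Set.mem_Ioi.1 hy)]; ring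
    have e2 : Set.EqOn (fun y => φ 0 * ((deriv cutoff y : ℝ) : ℂ) * J y)
        (fun y => (φ 0 * b) * ((deriv cutoff y : ℝ) : ℂ)) (Set.Iic 0) := fun y hy => by
      simp only [hJ, if_neg (not_lt.2 (Set.mem_Iic.1 hy))]; ring
    have i1 : IntegrableOn (fun y => φ 0 * ((deriv cutoff y : ℝ) : ℂ) * J y) (Set.Ioi 0) :=
      IntegrableOn.congr_fun (hi.const_mul _).integrableOn e1.symm measurableSet_Ioi
    have i2 : IntegrableOn (fun y => φ 0 * ((deriv cutoff y : ℝ) : ℂ) * J y) (Set.Iic 0) :=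
      IntegrableOn.congr_fun (hi.const_mul _).integrableOn e2.symm measurableSet_Iic
    rw [← intervalIntegral.integral_Iic_add_Ioi i2 i1, setIntegral_congr_fun measurableSet_Ioi e1,
      setIntegral_congr_fun measurableSet_Iic e2, integral_const_mul, integral_const_mul,
      integral_complex_ofReal, integral_complex_ofReal, integral_deriv_cutoff_Ioi,
      integral_deriv_cutoff_Iic]
    push_cast; ring
  rw [← hlim]
  -- The one-sided limits bound `φ G` only near `0`; this is enough because `deriv cutoff` vanishes
  -- for `|y| > 2`, where `r n * y` could leave that neighbourhood.
  obtain ⟨δ, hδ, M, hM⟩ : ∃ δ > 0, ∃ M, ∀ x, |x| < δ → x ≠ 0 → ‖φ x * G x‖ ≤ M := by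
    have h1 : ∀ᶠ x in 𝓝[>] (0 : ℝ), ‖φ x * G x‖ ≤ ‖φ 0 * a‖ + 1 :=
      ((((hφ.tendsto 0).mono_left nhdsWithin_le_nhds).mul ha).norm.eventually
        (ge_mem_nhds (lt_add_one _)))
    have h2 : ∀ᶠ x in 𝓝[<] (0 : ℝ), ‖φ x * G x‖ ≤ ‖φ 0 * b‖ + 1 :=
      ((((hφ.tendsto 0).mono_left nhdsWithin_le_nhds).mul hb).norm.eventually
        (ge_mem_nhds (lt_add_one _)))
    obtain ⟨δ₁, hδ₁, h1⟩ := Metric.mem_nhdsWithin_iff.1 h1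
    obtain ⟨δ₂, hδ₂, h2⟩ := Metric.mem_nhdsWithin_iff.1 h2
    refine ⟨min δ₁ δ₂, lt_min hδ₁ hδ₂, max (‖φ 0 * a‖ + 1) (‖φ 0 * b‖ + 1), fun x hx hx0 => ?_⟩
    rcases lt_or_gt_of_ne hx0 with h | h
    · exact le_max_of_le_right (h2 ⟨by simpa using hx.trans_le (min_le_right _ _), h⟩)
    · exact le_max_of_le_left (h1 ⟨by simpa using hx.trans_le (min_le_left _ _), h⟩)
  have hne0 : ∀ᵐ y ∂(volume : Measure ℝ), y ≠ 0 := by simp [ae_iff]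
  have hGm : ∀ n, AEStronglyMeasurable (fun y => G (r n * y)) volume := fun n => by
    have hc : ContinuousOn (fun y => G (r n * y)) {0}ᶜ :=
      hG.comp (by fun_prop) fun y hy => mul_ne_zero (hr n).ne' hy
    have := hc.aestronglyMeasurable (μ := volume) (measurableSet_singleton 0).compl
    have hr' : (volume : Measure ℝ).restrict {0}ᶜ = volume :=
      Measure.restrict_eq_self_of_ae_mem hne0
    rwa [hr'] at this
  refine tendsto_integral_filter_of_dominated_convergence
    (fun y => M * |deriv cutoff y|) ?_ ?_ ?_ ?_
  · refine .of_forall fun n => ?_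
    refine AEStronglyMeasurable.mul ?_ (hGm n)
    exact ((hφ.comp (by fun_prop)).mul
      (Complex.continuous_ofReal.comp continuous_deriv_cutoff)).aestronglyMeasurable
  · have h3 : ∀ᶠ n in atTop, r n * 2 < δ := by
      have : Tendsto (fun n => r n * 2) atTop (𝓝 0) := by simpa using hrl.mul_const 2
      exact this.eventually (gt_mem_nhds hδ)
    filter_upwards [h3] with n hn
    filter_upwards [hne0] with y hy
    by_cases hy2 : 2 < |y|
    · simp [deriv_cutoff_eq_zero hy2]
    · have h4 : |r n * y| < δ := by
        rw [abs_mul, abs_of_pos (hr n)]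
        exact (mul_le_mul_of_nonneg_left (not_lt.1 hy2) (hr n).le).trans_lt hn
      calc ‖φ (r n * y) * ((deriv cutoff y : ℝ) : ℂ) * G (r n * y)‖
          = ‖φ (r n * y) * G (r n * y)‖ * |deriv cutoff y| := by
            simp only [norm_mul, Complex.norm_real, Real.norm_eq_abs]; ring
        _ ≤ M * |deriv cutoff y| := by
            gcongr
            exact hM _ h4 (mul_ne_zero (hr n).ne' hy)
  · exact ((continuous_deriv_cutoff.integrable_of_hasCompactSupport
      hasCompactSupport_deriv_cutoff).abs).const_mul M
  · filter_upwards [hne0] with y hy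
    have h5 : Tendsto (fun n => r n * y) atTop (𝓝 0) := by simpa using hrl.mul_const y
    refine (((hφ.tendsto 0).comp h5).mul_const _).mul ?_
    rcases lt_or_gt_of_ne hy with h | h
    · simp only [hJ, if_neg (not_lt.2 h.le)]
      exact hb.comp (tendsto_nhdsWithin_iff.2 ⟨h5, .of_forall fun n =>
        Set.mem_Iio.2 (mul_neg_of_pos_of_neg (hr n) h)⟩)
    · simp only [hJ, if_pos h]
      exact ha.comp (tendsto_nhdsWithin_iff.2 ⟨h5, .of_forall fun n =>
        Set.mem_Ioi.2 (mul_pos (hr n) h)⟩)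

/-- The distributional derivative on `ℝ` of a function with a jump at `0`. -/
theorem HasWeakDerivOn.integral_deriv_mul_of_jump {g v : L2R} (h : HasWeakDerivOn {0}ᶜ g v)
    {G : ℝ → ℂ} {a b : ℂ} (hG : ContinuousOn G {0}ᶜ) (hgG : g =ᵐ[volume] G)
    (ha : Tendsto G (𝓝[>] 0) (𝓝 a)) (hb : Tendsto G (𝓝[<] 0) (𝓝 b))
    {φ : ℝ → ℂ} (hφ : ContDiff ℝ ∞ φ) (hc : HasCompactSupport φ) :
    ∫ x, deriv φ x * g x = -(∫ x, φ x * v x) + (b - a) * φ 0 := by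
  have hφd : ∀ x, HasDerivAt φ (deriv φ x) x := fun x =>
    (hφ.differentiable (by norm_num) x).hasDerivAt
  set r : ℕ → ℝ := fun n => ((n : ℝ) + 1)⁻¹ with hr
  have hr0 : ∀ n, 0 < r n := fun n => by positivity
  have hrl : Tendsto r atTop (𝓝 0) := by
    simpa [hr, one_div] using tendsto_one_div_add_atTop_nhds_zero_nat (𝕜 := ℝ)
  -- The test function is cut out near `0` to be admissible on the punctured line. The derivative of
  -- the cutoff then concentrates at `0` and leaves the jump.
  set Φ : ℕ → ℝ → ℂ := fun n x => φ x * (1 - cutoff ((r n)⁻¹ * x) : ℝ) with hΦ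
  have hcut : ∀ n, ContDiff ℝ ∞ fun x => (1 - cutoff ((r n)⁻¹ * x) : ℝ) := fun n =>
    contDiff_const.sub (contDiff_cutoff.comp (contDiff_const.mul contDiff_id))
  have hsm : ∀ n, ContDiff ℝ ∞ (Φ n) := fun n =>
    hφ.mul (Complex.ofRealCLM.contDiff.comp (hcut n))
  have hcs : ∀ n, HasCompactSupport (Φ n) := fun n => hc.mul_right
  have hts : ∀ n, tsupport (Φ n) ⊆ {0}ᶜ := fun n => by
    rw [Set.subset_compl_singleton_iff, notMem_tsupport_iff_eventuallyEq]
    have : ∀ᶠ x : ℝ in 𝓝 0, |(r n)⁻¹ * x| < 1 := by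
      have hcont : Continuous fun x : ℝ => |(r n)⁻¹ * x| := by fun_prop
      refine hcont.continuousAt.eventually (gt_mem_nhds ?_)
      simp
    filter_upwards [this] with x hx
    simp [hΦ, cutoff_eq_one hx.le]
  have hder : ∀ n x, deriv (Φ n) x = deriv φ x * ((1 - cutoff ((r n)⁻¹ * x) : ℝ) : ℂ) -
      φ x * (((r n)⁻¹ * deriv cutoff ((r n)⁻¹ * x) : ℝ) : ℂ) := fun n x => by
    have := ((hφd x).mul ((hasDerivAt_cutoff_mul (r n)⁻¹ x).const_sub 1).ofReal_comp).deriv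
    refine this.trans ?_
    push_cast; ring
  have hcl : ∀ x : ℝ, x ≠ 0 →
      Tendsto (fun n => ((1 - cutoff ((r n)⁻¹ * x) : ℝ) : ℂ)) atTop (𝓝 1) := fun x hx => by
    refine tendsto_const_nhds.congr' ?_
    have h1 : Tendsto (fun n => |(r n)⁻¹ * x|) atTop atTop := by
      simp only [hr, inv_inv, abs_mul]
      refine Tendsto.atTop_mul_const (abs_pos.2 hx) ?_
      exact tendsto_abs_atTop_atTop.comp
        (tendsto_atTop_add_const_right _ _ tendsto_natCast_atTop_atTop)
    filter_upwards [h1.eventually_ge_atTop 2] with n hn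
    simp [cutoff_eq_zero hn]
  have hle : ∀ n x, ‖((1 - cutoff ((r n)⁻¹ * x) : ℝ) : ℂ)‖ ≤ 1 := fun n x => by
    rw [Complex.norm_real, Real.norm_of_nonneg (sub_nonneg.2 cutoff.le_one)]
    linarith [cutoff.nonneg' ((r n)⁻¹ * x)]
  have hne0 : ∀ᵐ y ∂(volume : Measure ℝ), y ≠ 0 := by simp [ae_iff]
  have hcd : Continuous (deriv φ) := hφ.continuous_deriv (by norm_num)
  have lim : ∀ (ψ : ℝ → ℂ) (f : L2R), Continuous ψ → HasCompactSupport ψ →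
      Tendsto (fun n => ∫ x, ψ x * ((1 - cutoff ((r n)⁻¹ * x) : ℝ) : ℂ) * f x) atTop
        (𝓝 (∫ x, ψ x * f x)) := fun ψ f hψ hψc => by
    refine tendsto_integral_of_dominated_convergence (fun x => ‖ψ x * f x‖) (fun n => ?_)
      (integrable_mul_L2 hψ hψc f).norm (fun n => .of_forall fun x => ?_) ?_
    · exact (hψ.mul (Complex.continuous_ofReal.comp (hcut n).continuous)).aestronglyMeasurable.mul
        (Lp.aestronglyMeasurable f)
    · rw [norm_mul, norm_mul, norm_mul]
      gcongr
      exact mul_le_of_le_one_right (norm_nonneg _) (hle n x)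
    · filter_upwards [hne0] with x hx
      simpa using ((hcl x hx).const_mul (ψ x)).mul_const (f x)
  have L1 := lim (deriv φ) g hcd hc.deriv
  have L2 := lim φ v hφ.continuous hc
  have L3 := tendsto_integral_deriv_cutoff hφ.continuous hG ha hb hr0 hrl
  have key : ∀ n, ∫ x, deriv φ x * ((1 - cutoff ((r n)⁻¹ * x) : ℝ) : ℂ) * g x =
      -(∫ x, φ x * ((1 - cutoff ((r n)⁻¹ * x) : ℝ) : ℂ) * v x) +
        ∫ x, φ x * (((r n)⁻¹ * deriv cutoff ((r n)⁻¹ * x) : ℝ) : ℂ) * G x := fun n => by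
    have h1 := h.integral_deriv_mul (hsm n) (hcs n) (hts n)
    have i1 : Integrable fun x => deriv φ x * ((1 - cutoff ((r n)⁻¹ * x) : ℝ) : ℂ) * g x :=
      integrable_mul_L2 (hcd.mul (Complex.continuous_ofReal.comp (hcut n).continuous))
        hc.deriv.mul_right g
    have i2 : Integrable fun x =>
        φ x * (((r n)⁻¹ * deriv cutoff ((r n)⁻¹ * x) : ℝ) : ℂ) * g x :=
      integrable_mul_L2 (hφ.continuous.mul (Complex.continuous_ofReal.comp
        (continuous_const.mul (continuous_deriv_cutoff.comp (continuous_const.mul continuous_id)))))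
        hc.mul_right g
    have e : ∫ x, φ x * (((r n)⁻¹ * deriv cutoff ((r n)⁻¹ * x) : ℝ) : ℂ) * G x =
        ∫ x, φ x * (((r n)⁻¹ * deriv cutoff ((r n)⁻¹ * x) : ℝ) : ℂ) * g x :=
      integral_congr_ae (by filter_upwards [hgG] with x hx; rw [hx])
    simp_rw [hder, sub_mul] at h1
    rw [integral_sub i1 i2] at h1
    rw [e]
    linear_combination h1
  have := tendsto_nhds_unique (L1.congr key) (L2.neg.add L3)
  rw [this]
  ring

end DeltaPotential

namespace DeltaPotential

open SchwartzMap BoundedContinuousFunction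

/-! ### The operator `-Δ_γ + lam` in Fourier variables -/

theorem integral_schwartz_mul_neg_add (ψ : 𝓢(ℝ, ℂ)) (k : L2R) (c : ℂ) :
    ∫ ξ, ψ ξ * (-k ξ + c) = -(∫ ξ, ψ ξ * k ξ) + c * ∫ ξ, ψ ξ := by
  rw [← integral_neg, ← integral_const_mul,
    ← integral_add (integrable_schwartz_mul ψ k).fun_neg (ψ.integrable.const_mul c)]
  congr 1 with ξ
  ring

/-- An equation `f' = g - c δ` in Fourier variables. -/
theorem fourier_ae_eq_of_integral_deriv_mul {f g : L2R} {c : ℂ}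
    (H : ∀ φ : ℝ → ℂ, ContDiff ℝ ∞ φ → HasCompactSupport φ →
      ∫ x, deriv φ x * f x = -(∫ x, φ x * g x) + c * φ 0) :
    (fun ξ : ℝ => -(2 * Real.pi * Complex.I) * ξ * (𝓕 f : L2R) ξ) =ᵐ[volume]
      fun ξ => -(𝓕 g : L2R) ξ + c := by
  have hk : LocallyIntegrable fun ξ => -(𝓕 g : L2R) ξ + c :=
    (L2R.locallyIntegrable _).neg.add (locallyIntegrable_const c)
  refine ae_eq_of_integral_mulSymb_mul_eq hk fun ψ => ?_
  have h := integral_deriv_mul_schwartz H (𝓕 ψ)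
  simp_rw [deriv_fourier_schwartz] at h
  rw [integral_fourier_mul, integral_fourier_mul, fourier_schwartz_zero] at h
  rw [h, integral_schwartz_mul_neg_add]

/-- Converse of `fourier_ae_eq_of_integral_deriv_mul`: every test function is the transform of a
Schwartz function `ψ`, and the identity is integrated against `ψ`. -/
theorem integral_deriv_mul_of_fourier_ae_eq {f g : L2R} {c : ℂ}
    (H : (fun ξ : ℝ => -(2 * Real.pi * Complex.I) * ξ * (𝓕 f : L2R) ξ) =ᵐ[volume]
      fun ξ => -(𝓕 g : L2R) ξ + c) {φ : ℝ → ℝ} (hφ : ContDiff ℝ ∞ φ) (hc : HasCompactSupport φ) :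
    ∫ x, deriv φ x • f x = -(∫ x, φ x • g x) + c * φ 0 := by
  have hc1 : HasCompactSupport (Complex.ofRealCLM ∘ φ) := hc.comp_left rfl
  have hφ1 : ContDiff ℝ ∞ (Complex.ofRealCLM ∘ φ) := by fun_prop
  obtain ⟨ψ, hψ⟩ : ∃ ψ : 𝓢(ℝ, ℂ), 𝓕 ψ = hc1.toSchwartzMap hφ1 :=
    ⟨𝓕⁻ (hc1.toSchwartzMap hφ1), FourierTransform.fourier_fourierInv_eq _⟩
  have hv : ∀ x, (𝓕 ψ : 𝓢(ℝ, ℂ)) x = φ x := fun x => by rw [hψ]; rfl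
  have hd : ∀ x, (𝓕 (mulSymb ψ) : 𝓢(ℝ, ℂ)) x = deriv φ x := fun x => by
    rw [← deriv_fourier_schwartz, hψ]
    exact (hφ.differentiable (by norm_num) x).hasDerivAt.ofReal_comp.deriv
  have e1 : ∫ x, deriv φ x • f x = ∫ x, (𝓕 (mulSymb ψ) : 𝓢(ℝ, ℂ)) x * f x := by
    simp_rw [hd, Complex.real_smul]
  have e2 : ∫ x, φ x • g x = ∫ x, (𝓕 ψ : 𝓢(ℝ, ℂ)) x * g x := by
    simp_rw [hv, Complex.real_smul]
  rw [e1, e2, ← hv 0, integral_fourier_mul, integral_fourier_mul, fourier_schwartz_zero]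
  have e3 : ∫ ξ, mulSymb ψ ξ * (𝓕 f : L2R) ξ = ∫ ξ, ψ ξ * (-(𝓕 g : L2R) ξ + c) := by
    refine integral_congr_ae ?_
    filter_upwards [H] with ξ hξ
    rw [← hξ, mulSymb_apply]
    ring
  rw [e3, integral_schwartz_mul_neg_add]

theorem integrable_mulOp_of_memLp {w : ℝ →ᵇ ℂ} (hw : MemLp w 2 volume) (y : L2R) :
    Integrable (mulOp w y) :=
  (MemLp.integrable_mul hw (Lp.memLp y)).congr (mulOp_coeFn w y).symm

theorem memLp_powBcf_one {lam : ℝ} (h : 0 < lam) : MemLp (powBcf lam 1) 2 volume := by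
  have : ⇑(powBcf lam 1) = fun ξ => (((symb lam ξ)⁻¹ : ℝ) : ℂ) := funext (powBcf_one_apply h)
  rw [this]
  exact (memLp_symb_inv h).ofReal

theorem integrable_symbInv {lam : ℝ} (h : 0 < lam) : Integrable (symbInv lam) := by
  have h1 : Integrable fun ξ => (symb lam ξ)⁻¹ := by
    simpa only [Real.rpow_neg_one] using integrable_symb_rpow h (β := 1) (by norm_num)
  exact h1.ofReal.congr (symbInv_coeFn h).symm

theorem integral_symbInv {lam : ℝ} (h : 0 < lam) :
    ∫ ξ, symbInv lam ξ = (((2 * √lam)⁻¹ : ℝ) : ℂ) := by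
  rw [integral_congr_ae (symbInv_coeFn h), integral_complex_ofReal, integral_symb_inv h]

theorem integral_mulOp_powBcf_one {lam : ℝ} (h : 0 < lam) (y : L2R) :
    ∫ ξ, mulOp (powBcf lam 1) y ξ = inner ℂ (symbInv lam) y := by
  rw [L2.inner_def]
  refine integral_congr_ae ?_
  filter_upwards [mulOp_coeFn (powBcf lam 1) y, symbInv_coeFn h] with ξ h1 h2
  rw [h1, h2, powBcf_one_apply h, RCLike.inner_apply, Complex.conj_ofReal, mul_comm]

theorem integrable_mulOp_add_smul {lam : ℝ} (h : 0 < lam) (y : L2R) (c : ℂ) :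
    Integrable (mulOp (powBcf lam 1) y + c • symbInv lam : L2R) := by
  refine ((integrable_mulOp_of_memLp (memLp_powBcf_one h) y).add
    ((integrable_symbInv h).smul c)).congr ?_
  filter_upwards [Lp.coeFn_add (mulOp (powBcf lam 1) y) (c • symbInv lam),
    Lp.coeFn_smul c (symbInv lam)] with ξ h1 h2
  rw [h1, Pi.add_apply, Pi.add_apply, h2]

/-- By Fourier inversion the integral is the value at `0` of the function whose transform is `(y +
c) / symb lam`. -/
theorem integral_mulOp_add_smul {lam : ℝ} (h : 0 < lam) (y : L2R) (c : ℂ) :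
    ∫ ξ, (mulOp (powBcf lam 1) y + c • symbInv lam : L2R) ξ =
      inner ℂ (symbInv lam) y + c * (((2 * √lam)⁻¹ : ℝ) : ℂ) := by
  rw [← integral_mulOp_powBcf_one h, ← integral_symbInv h, ← integral_const_mul,
    ← integral_add (integrable_mulOp_of_memLp (memLp_powBcf_one h) y)
      ((integrable_symbInv h).const_mul c)]
  refine integral_congr_ae ?_
  filter_upwards [Lp.coeFn_add (mulOp (powBcf lam 1) y) (c • symbInv lam),
    Lp.coeFn_smul c (symbInv lam)] with ξ h1 h2
  rw [h1, Pi.add_apply, h2, Pi.smul_apply, smul_eq_mul]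

theorem mulOp_add_smul_coeFn {lam : ℝ} (h : 0 < lam) (y : L2R) (c : ℂ) :
    (mulOp (powBcf lam 1) y + c • symbInv lam : L2R) =ᵐ[volume]
      fun ξ => (((symb lam ξ)⁻¹ : ℝ) : ℂ) * (y ξ + c) := by
  filter_upwards [Lp.coeFn_add (mulOp (powBcf lam 1) y) (c • symbInv lam),
    Lp.coeFn_smul c (symbInv lam), mulOp_coeFn (powBcf lam 1) y, symbInv_coeFn h] with ξ h1 h2 h3 h4
  rw [h1, Pi.add_apply, h2, Pi.smul_apply, smul_eq_mul, h3, h4, powBcf_one_apply h]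
  ring

theorem fourier_add_smul_coeFn (u f : L2R) (c : ℂ) :
    (𝓕 (u + c • f) : L2R) =ᵐ[volume] fun ξ => (𝓕 u : L2R) ξ + c * (𝓕 f : L2R) ξ := by
  have : (𝓕 (u + c • f) : L2R) = 𝓕 u + c • 𝓕 f := by
    rw [FourierTransform.fourier_add, FourierTransform.fourier_smul]
  rw [this]
  filter_upwards [Lp.coeFn_add (𝓕 u : L2R) (c • 𝓕 f), Lp.coeFn_smul c (𝓕 f : L2R)] with ξ h1 h2
  rw [h1, Pi.add_apply, h2, Pi.smul_apply, smul_eq_mul]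

/-- Here `w` is the strength `γ f(0)` of the delta source, which itself contributes `w / (2√lam)` to
`f(0)`. Solving this linear equation produces the Krein coefficient. -/
theorem kreinCoef_spec {γ lam : ℝ} (h : 0 < lam) (hγ : γ < 2 * √lam) (z w : ℂ) :
    w = (γ : ℂ) * (z + w * (((2 * √lam)⁻¹ : ℝ) : ℂ)) ↔ w = (kreinCoef γ lam : ℂ) * z := by
  have h2 : 0 < √lam := Real.sqrt_pos.2 h
  have h3 : 2 * √lam - γ ≠ 0 := by linarith
  have h4 : (√lam : ℂ) ≠ 0 := by exact_mod_cast h2.ne'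
  have h5 : (2 * √lam - γ : ℂ) ≠ 0 := by exact_mod_cast h3
  unfold kreinCoef
  push_cast
  field_simp
  constructor <;> intro H <;> linear_combination H

/-- The Fourier transform of an element of the domain of `-Δ_γ`. -/
theorem IsDeltaLaplacian.fourier_eq {γ lam : ℝ} (h : 0 < lam) (hγ : γ < 2 * √lam) {f u : L2R}
    (H : IsDeltaLaplacian γ f u) : 𝓕 f = fourierRes γ lam (𝓕 (u + (lam : ℂ) • f)) := by
  obtain ⟨g, h1, h2, F, G, a, b, hF, hfF, hG, hgG, ha, hb, hab⟩ := H
  set c : ℂ := γ * F 0 with hc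
  set y : L2R := 𝓕 (u + (lam : ℂ) • f) with hy
  have e1 := fourier_ae_eq_of_integral_deriv_mul (f := f) (g := g) (c := 0) fun φ hφ hφc => by
    rw [h1.integral_deriv_mul hφ hφc (Set.subset_univ _), zero_mul, add_zero]
  have e2 := fourier_ae_eq_of_integral_deriv_mul (f := g) (g := -u) (c := c) fun φ hφ hφc => by
    rw [h2.integral_deriv_mul_of_jump hG hgG ha hb hφ hφc]
    congr 2
    linear_combination -hab
  -- The two equations are `f' = g` and `g' = -u - c δ`. Eliminating the transform of `g` leaves
  -- `symb lam * 𝓕 f = y + c`.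
  have e3 : 𝓕 f = mulOp (powBcf lam 1) y + c • symbInv lam := by
    apply Lp.ext
    have e4 : (𝓕 (-u) : L2R) = -𝓕 u := FourierTransform.fourier_neg u
    rw [e4] at e2
    filter_upwards [e1, e2, Lp.coeFn_neg (𝓕 u : L2R), fourier_add_smul_coeFn u f lam,
      mulOp_add_smul_coeFn h y c] with ξ k1 k2 k3 k4 k5
    rw [k5, hy, k4]
    rw [k3, Pi.neg_apply] at k2
    have hs : (symb lam ξ : ℂ) ≠ 0 := by exact_mod_cast (symb_pos h ξ).ne'
    rw [Complex.ofReal_inv, eq_inv_mul_iff_mul_eq₀ hs, symb]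
    push_cast
    linear_combination k2 + (2 * Real.pi * Complex.I) * ξ * k1 +
      (2 * Real.pi * ξ) ^ 2 * (𝓕 f : L2R) ξ * Complex.I_sq
  have hi : Integrable (𝓕 f : L2R) := by rw [e3]; exact integrable_mulOp_add_smul h y c
  have hFeq : F = 𝓕⁻ ((𝓕 f : L2R) : ℝ → ℂ) := by
    refine (Continuous.ae_eq_iff_eq volume hF (continuous_fourierInv_of_integrable hi)).1 ?_
    refine hfF.symm.trans ?_
    have := fourierInv_coeFn_of_integrable hi
    rwa [FourierTransform.fourierInv_fourier_eq] at this
  have hF0 : F 0 = inner ℂ (symbInv lam) y + c * (((2 * √lam)⁻¹ : ℝ) : ℂ) := by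
    rw [hFeq, Real.fourierInv_eq, ← integral_mulOp_add_smul h, ← e3]
    simp
  rw [fourierRes_apply, smul_smul, ← (kreinCoef_spec h hγ _ c).1 (by rw [← hF0])]
  exact e3

/-! ### From Krein's formula back to the domain -/

theorem norm_derivSymb_le {lam : ℝ} (h : 0 < lam) (ξ : ℝ) :
    ‖2 * Real.pi * Complex.I * ξ * (((symb lam ξ)⁻¹ : ℝ) : ℂ)‖ ≤ symb lam ξ ^ (-(1 / 2 : ℝ)) := by
  have h0 := symb_pos h ξ
  have h1 : ‖2 * Real.pi * Complex.I * ξ * (((symb lam ξ)⁻¹ : ℝ) : ℂ)‖ =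
      |2 * Real.pi * ξ| * (symb lam ξ)⁻¹ := by
    rw [norm_mul, Complex.norm_real, Real.norm_of_nonneg (inv_nonneg.2 h0.le)]
    simp [abs_mul, abs_of_pos Real.pi_pos]
  have h2 : |2 * Real.pi * ξ| ≤ symb lam ξ ^ (1 / 2 : ℝ) := by
    rw [← Real.sqrt_eq_rpow]
    exact Real.abs_le_sqrt (le_add_of_nonneg_left h.le)
  rw [h1]
  calc |2 * Real.pi * ξ| * (symb lam ξ)⁻¹ ≤ symb lam ξ ^ (1 / 2 : ℝ) * symb lam ξ ^ (-1 : ℝ) := by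
        rw [Real.rpow_neg_one]
        gcongr
    _ = symb lam ξ ^ (-(1 / 2 : ℝ)) := by rw [← Real.rpow_add h0]; norm_num

theorem continuous_derivSymb {lam : ℝ} (h : 0 < lam) :
    Continuous fun ξ : ℝ => 2 * Real.pi * Complex.I * ξ * (((symb lam ξ)⁻¹ : ℝ) : ℂ) := by
  have := Complex.continuous_ofReal.comp
    ((continuous_symb lam).inv₀ fun ξ => (symb_pos h ξ).ne')
  exact (by fun_prop : Continuous fun ξ : ℝ => 2 * Real.pi * Complex.I * (ξ : ℂ)).mul this

theorem memLp_derivSymb {lam : ℝ} (h : 0 < lam) :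
    MemLp (fun ξ : ℝ => 2 * Real.pi * Complex.I * ξ * (((symb lam ξ)⁻¹ : ℝ) : ℂ)) 2 volume :=
  (memLp_symb_rpow h (β := 1 / 2) (by norm_num)).mono
    (continuous_derivSymb h).aestronglyMeasurable
    (.of_forall fun ξ => (norm_derivSymb_le h ξ).trans (le_abs_self _))

theorem exists_bcf_derivSymb {lam : ℝ} (h : 0 < lam) : ∃ w : ℝ →ᵇ ℂ, ∀ ξ : ℝ,
    w ξ = 2 * Real.pi * Complex.I * ξ * (((symb lam ξ)⁻¹ : ℝ) : ℂ) :=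
  ⟨BoundedContinuousFunction.ofNormedAddCommGroup _ (continuous_derivSymb h)
    (lam ^ (-(1 / 2 : ℝ))) fun ξ => (norm_derivSymb_le h ξ).trans
      (Real.rpow_le_rpow_of_nonpos h (le_symb _ _) (by norm_num)), fun _ => rfl⟩

/-- The derivative of `e^{-κ|x|} / (2κ)`. -/
noncomputable def jumpExp (κ x : ℝ) : ℂ :=
  if 0 < x then -(Complex.exp (-κ * x) / 2) else Complex.exp (κ * x) / 2

theorem jumpExp_eqOn_Ioi (κ : ℝ) :
    Set.EqOn (jumpExp κ) (fun x : ℝ => -(Complex.exp (-κ * x) / 2)) (Set.Ioi 0) :=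
  fun _ hx => if_pos hx

theorem jumpExp_eqOn_Iic (κ : ℝ) :
    Set.EqOn (jumpExp κ) (fun x : ℝ => Complex.exp (κ * x) / 2) (Set.Iic 0) :=
  fun _ hx => if_neg (not_lt.2 hx)

theorem continuousOn_jumpExp (κ : ℝ) : ContinuousOn (jumpExp κ) {0}ᶜ := by
  intro x hx
  refine ContinuousAt.continuousWithinAt ?_
  rcases lt_or_gt_of_ne hx with h | h
  · refine ContinuousAt.congr (f := fun x : ℝ => Complex.exp (κ * x) / 2) (by fun_prop) ?_
    filter_upwards [Iio_mem_nhds h] with y hy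
    exact (jumpExp_eqOn_Iic κ (Set.mem_Iic.2 (Set.mem_Iio.1 hy).le)).symm
  · refine ContinuousAt.congr (f := fun x : ℝ => -(Complex.exp (-κ * x) / 2)) (by fun_prop) ?_
    filter_upwards [Ioi_mem_nhds h] with y hy
    exact (jumpExp_eqOn_Ioi κ hy).symm

theorem tendsto_jumpExp_right (κ : ℝ) : Tendsto (jumpExp κ) (𝓝[>] 0) (𝓝 (-(1 / 2))) := by
  have h : Continuous fun x : ℝ => -(Complex.exp (-κ * x) / 2) := by fun_prop
  have h1 := (h.tendsto 0).mono_left (nhdsWithin_le_nhds (s := Set.Ioi 0))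
  simp only [Complex.ofReal_zero, mul_zero, Complex.exp_zero] at h1
  refine h1.congr' ?_
  filter_upwards [self_mem_nhdsWithin] with y hy
  exact (jumpExp_eqOn_Ioi κ hy).symm

theorem tendsto_jumpExp_left (κ : ℝ) : Tendsto (jumpExp κ) (𝓝[<] 0) (𝓝 (1 / 2)) := by
  have h : Continuous fun x : ℝ => Complex.exp (κ * x) / 2 := by fun_prop
  have h1 := (h.tendsto 0).mono_left (nhdsWithin_le_nhds (s := Set.Iio 0))
  simp only [Complex.ofReal_zero, mul_zero, Complex.exp_zero] at h1
  refine h1.congr' ?_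
  filter_upwards [self_mem_nhdsWithin] with y hy
  exact (jumpExp_eqOn_Iic κ (Set.mem_Iic.2 (Set.mem_Iio.1 hy).le)).symm

theorem integrable_of_Iic_of_Ioi {d : ℝ → ℂ} (h1 : IntegrableOn d (Set.Iic 0))
    (h2 : IntegrableOn d (Set.Ioi 0)) : Integrable d := by
  rw [← integrableOn_univ, ← Set.Iic_union_Ioi (a := (0 : ℝ))]
  exact h1.union h2

theorem integrable_jumpExp {κ : ℝ} (h : 0 < κ) : Integrable (jumpExp κ) := by
  refine integrable_of_Iic_of_Ioi ?_ ?_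
  · exact IntegrableOn.congr_fun
      ((integrableOn_exp_mul_complex_Iic (a := κ) (by simpa using h) 0).div_const 2)
      (jumpExp_eqOn_Iic κ).symm measurableSet_Iic
  · exact IntegrableOn.congr_fun
      ((integrableOn_exp_mul_complex_Ioi (a := -κ) (by simpa using h) 0).div_const 2).neg
      (jumpExp_eqOn_Ioi κ).symm measurableSet_Ioi

theorem norm_jumpExp_le {κ : ℝ} (h : 0 < κ) (x : ℝ) : ‖jumpExp κ x‖ ≤ 1 := by
  unfold jumpExp
  split_ifs with hx
  · rw [norm_neg, norm_div, Complex.norm_exp]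
    have : Real.exp (-κ * x : ℂ).re ≤ 1 := by
      rw [Real.exp_le_one_iff]
      simp
      positivity
    simp only [Complex.norm_ofNat]
    linarith
  · rw [norm_div, Complex.norm_exp]
    have : Real.exp (κ * x : ℂ).re ≤ 1 := by
      rw [Real.exp_le_one_iff]
      simp
      exact mul_nonpos_of_nonneg_of_nonpos h.le (not_lt.1 hx)
    simp only [Complex.norm_ofNat]
    linarith

theorem memLp_jumpExp {κ : ℝ} (h : 0 < κ) : MemLp (jumpExp κ) 2 volume := by
  have hm := (integrable_jumpExp h).aestronglyMeasurable
  rw [memLp_two_iff_integrable_sq_norm hm]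
  refine (integrable_jumpExp h).norm.mono' (hm.norm.pow 2) (.of_forall fun x => ?_)
  rw [norm_pow, norm_norm, sq]
  exact mul_le_of_le_one_left (norm_nonneg _) (norm_jumpExp_le h x)

/-- The right side decays only like `1 / ξ`, so it is not integrable and its inverse transform is
discontinuous. The transform of `jumpExp` is instead computed directly, as `1 / (2B)` from the left
half line plus `1 / (2A)` from the right, with `symb lam ξ = -A B`. -/
theorem fourier_jumpExp {lam : ℝ} (h : 0 < lam) (ξ : ℝ) :
    𝓕 (jumpExp √lam) ξ = 2 * Real.pi * Complex.I * ξ * (((symb lam ξ)⁻¹ : ℝ) : ℂ) := by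
  have hs : 0 < √lam := Real.sqrt_pos.2 h
  have hsq : (√lam : ℂ) ^ 2 = lam := by exact_mod_cast Real.sq_sqrt h.le
  set κ := √lam
  set A : ℂ := -κ - 2 * Real.pi * ξ * Complex.I with hA
  set B : ℂ := κ - 2 * Real.pi * ξ * Complex.I with hB
  have hAre : A.re < 0 := by simp [hA, hs]
  have hBre : 0 < B.re := by simp [hB, hs]
  have hA0 : A ≠ 0 := fun h => by simp [h] at hAre
  have hB0 : B ≠ 0 := fun h => by simp [h] at hBre
  have e1 : Set.EqOn (fun x : ℝ => Complex.exp (↑(-2 * Real.pi * x * ξ) * Complex.I) • jumpExp κ x)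
      (fun x : ℝ => -(Complex.exp (A * x) / 2)) (Set.Ioi 0) := fun x hx => by
    simp only [jumpExp_eqOn_Ioi κ hx, smul_eq_mul]
    rw [mul_neg, ← mul_div_assoc, ← Complex.exp_add, hA]
    congr 3
    push_cast; ring
  have e2 : Set.EqOn (fun x : ℝ => Complex.exp (↑(-2 * Real.pi * x * ξ) * Complex.I) • jumpExp κ x)
      (fun x : ℝ => Complex.exp (B * x) / 2) (Set.Iic 0) := fun x hx => by
    simp only [jumpExp_eqOn_Iic κ hx, smul_eq_mul]
    rw [← mul_div_assoc, ← Complex.exp_add, hB]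
    congr 2
    push_cast; ring
  have i1 := IntegrableOn.congr_fun
    ((integrableOn_exp_mul_complex_Ioi hAre 0).div_const 2).neg e1.symm
    measurableSet_Ioi
  have i2 := IntegrableOn.congr_fun ((integrableOn_exp_mul_complex_Iic hBre 0).div_const 2) e2.symm
    measurableSet_Iic
  rw [Real.fourier_real_eq_integral_exp_smul, ← intervalIntegral.integral_Iic_add_Ioi i2 i1,
    setIntegral_congr_fun measurableSet_Iic e2, setIntegral_congr_fun measurableSet_Ioi e1,
    integral_neg, integral_div, integral_div, integral_exp_mul_complex_Iic hBre,
    integral_exp_mul_complex_Ioi hAre]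
  have hsy : (symb lam ξ : ℂ) = -(A * B) := by
    rw [symb, hA, hB]
    push_cast
    linear_combination -hsq + (2 * Real.pi * ξ) ^ 2 * Complex.I_sq
  rw [Complex.ofReal_inv, hsy]
  simp only [Complex.ofReal_zero, mul_zero, Complex.exp_zero]
  field_simp
  rw [hA, hB]
  ring

theorem fourier_toLp_jumpExp {lam : ℝ} (h : 0 < lam) :
    (𝓕 ((memLp_jumpExp (Real.sqrt_pos.2 h)).toLp _) : L2R) = (memLp_derivSymb h).toLp _ := by
  have hs : 0 < √lam := Real.sqrt_pos.2 h
  have hd := (memLp_jumpExp hs).coeFn_toLp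
  have hi : Integrable ((memLp_jumpExp hs).toLp _ : L2R) := (integrable_jumpExp hs).congr hd.symm
  have e : 𝓕 (((memLp_jumpExp hs).toLp _ : L2R) : ℝ → ℂ) = 𝓕 (jumpExp √lam) := by
    ext ξ
    rw [Real.fourier_eq, Real.fourier_eq]
    refine integral_congr_ae ?_
    filter_upwards [hd] with x hx
    rw [hx]
  apply Lp.ext
  filter_upwards [fourier_coeFn_of_integrable hi, (memLp_derivSymb h).coeFn_toLp] with ξ h1 h2
  rw [h1, h2, e, fourier_jumpExp h]

/-- The derivative of `f` splits into a part whose transform `w y` is integrable, as a product of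
two square integrable functions, hence continuous, and `c` times `jumpExp`, which carries the whole
jump `-c`. The boundary condition is then `c = γ f(0)`, which is `kreinCoef_spec`. -/
theorem isDeltaLaplacian_of_fourier_eq {γ lam : ℝ} (h : 0 < lam) (hγ : γ < 2 * √lam) {f u : L2R}
    (H : 𝓕 f = fourierRes γ lam (𝓕 (u + (lam : ℂ) • f))) : IsDeltaLaplacian γ f u := by
  set y : L2R := 𝓕 (u + (lam : ℂ) • f) with hy
  obtain ⟨c, hc⟩ : ∃ c, c = (kreinCoef γ lam : ℂ) * inner ℂ (symbInv lam) y := ⟨_, rfl⟩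
  rw [fourierRes_apply, smul_smul, ← hc] at H
  obtain ⟨w, hw⟩ := exists_bcf_derivSymb h
  have hw2 : MemLp w 2 volume := by
    rw [show ⇑w = _ from funext hw]
    exact memLp_derivSymb h
  have hs : 0 < √lam := Real.sqrt_pos.2 h
  set d : L2R := (memLp_jumpExp hs).toLp _ with hd
  have hdq : (𝓕 d : L2R) = (memLp_derivSymb h).toLp _ := fourier_toLp_jumpExp h
  set g : L2R := 𝓕⁻ (mulOp w y) + c • d with hg
  have hgF : (𝓕 g : L2R) =ᵐ[volume] fun ξ : ℝ => 2 * Real.pi * Complex.I * ξ * (𝓕 f : L2R) ξ := by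
    rw [hg]
    filter_upwards [fourier_add_smul_coeFn (𝓕⁻ (mulOp w y)) d c, mulOp_coeFn w y,
      (memLp_derivSymb h).coeFn_toLp, mulOp_add_smul_coeFn h y c] with ξ h1 h2 h3 h4
    rw [h1, FourierTransform.fourier_fourierInv_eq, h2, hdq, h3, H, h4, hw]
    ring
  have e1 : (fun ξ : ℝ => -(2 * Real.pi * Complex.I) * ξ * (𝓕 f : L2R) ξ) =ᵐ[volume]
      fun ξ => -(𝓕 g : L2R) ξ + 0 := by
    filter_upwards [hgF] with ξ hξ
    rw [hξ]; ring
  have e2 : (fun ξ : ℝ => -(2 * Real.pi * Complex.I) * ξ * (𝓕 g : L2R) ξ) =ᵐ[volume]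
      fun ξ => -(𝓕 (-u) : L2R) ξ + c := by
    have e4 : (𝓕 (-u) : L2R) = -𝓕 u := FourierTransform.fourier_neg u
    rw [e4]
    filter_upwards [hgF, Lp.coeFn_neg (𝓕 u : L2R), fourier_add_smul_coeFn u f lam,
      mulOp_add_smul_coeFn h y c] with ξ k1 k3 k4 k5
    rw [← H, hy, k4] at k5
    have hs : (symb lam ξ : ℂ) ≠ 0 := by exact_mod_cast (symb_pos h ξ).ne'
    rw [Complex.ofReal_inv, eq_inv_mul_iff_mul_eq₀ hs, symb] at k5
    push_cast at k5
    rw [k1, k3, Pi.neg_apply]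
    linear_combination k5 - (2 * Real.pi * ξ) ^ 2 * (𝓕 f : L2R) ξ * Complex.I_sq
  have hi : Integrable (𝓕 f : L2R) := by rw [H]; exact integrable_mulOp_add_smul h y c
  have hi1 := integrable_mulOp_of_memLp hw2 y
  set G₁ : ℝ → ℂ := 𝓕⁻ ((mulOp w y : L2R) : ℝ → ℂ) with hG₁
  have hG₁c : Continuous G₁ := continuous_fourierInv_of_integrable hi1
  refine ⟨g, fun φ hφ hφc _ => ?_, fun φ hφ hφc hφ0 => ?_, 𝓕⁻ ((𝓕 f : L2R) : ℝ → ℂ),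
    fun x => G₁ x + c * jumpExp √lam x, G₁ 0 + c * (-(1 / 2)), G₁ 0 + c * (1 / 2),
    continuous_fourierInv_of_integrable hi, ?_,
    hG₁c.continuousOn.add (continuousOn_const.mul (continuousOn_jumpExp _)), ?_,
    ((hG₁c.tendsto 0).mono_left nhdsWithin_le_nhds).add ((tendsto_jumpExp_right _).const_mul c),
    ((hG₁c.tendsto 0).mono_left nhdsWithin_le_nhds).add ((tendsto_jumpExp_left _).const_mul c), ?_⟩
  · rw [integral_deriv_mul_of_fourier_ae_eq e1 hφ hφc, zero_mul, add_zero]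
  -- Test functions supported off `0` do not see the delta term.
  · have h0 : φ 0 = 0 := image_eq_zero_of_notMem_tsupport fun h0 => hφ0 h0 rfl
    rw [integral_deriv_mul_of_fourier_ae_eq e2 hφ hφc, h0, Complex.ofReal_zero, mul_zero, add_zero]
  · have := fourierInv_coeFn_of_integrable hi
    rwa [FourierTransform.fourierInv_fourier_eq] at this
  · filter_upwards [Lp.coeFn_add (𝓕⁻ (mulOp w y) : L2R) (c • d), Lp.coeFn_smul c d,
      fourierInv_coeFn_of_integrable hi1, (memLp_jumpExp hs).coeFn_toLp] with x h1 h2 h3 h4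
    rw [hg, h1, Pi.add_apply, h2, h3, Pi.smul_apply, smul_eq_mul, hd, h4]
  · have hF0 : 𝓕⁻ ((𝓕 f : L2R) : ℝ → ℂ) 0 =
        inner ℂ (symbInv lam) y + c * (((2 * √lam)⁻¹ : ℝ) : ℂ) := by
      rw [Real.fourierInv_eq, ← integral_mulOp_add_smul h, ← H]
      simp
    rw [hF0]
    linear_combination -(kreinCoef_spec h hγ _ c).2 hc

theorem isDeltaLaplacian_iff {γ lam : ℝ} (h : 0 < lam) (hγ : γ < 2 * √lam) {f u : L2R} :
    IsDeltaLaplacian γ f u ↔ 𝓕 f = fourierRes γ lam (𝓕 (u + (lam : ℂ) • f)) :=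
  ⟨fun H => H.fourier_eq h hγ, isDeltaLaplacian_of_fourier_eq h hγ⟩

end DeltaPotential

namespace DeltaPotential

/-! ### Operators with a bounded inverse -/

section Inverse

variable {H : Type*} [NormedAddCommGroup H] [InnerProductSpace ℂ H]

theorem IsBoundedInverse.apply_eq_zero {T : H →ₗ.[ℂ] H} {R : H →L[ℂ] H} (h : IsBoundedInverse T R)
    {y : H} (hy : R y = 0) : y = 0 :=
  T.graph_fst_eq_zero_snd ((h 0 y).2 hy) rfl

theorem IsBoundedInverse.mem_domain_iff {T : H →ₗ.[ℂ] H} {R : H →L[ℂ] H}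
    (h : IsBoundedInverse T R) {x : H} : x ∈ T.domain ↔ ∃ y, R y = x := by
  rw [LinearPMap.mem_domain_iff]
  exact exists_congr fun y => h x y

variable [CompleteSpace H]

/-- The domain is the range of `R`, whose orthogonal complement is the kernel of the symmetric
injective `R`; so it is dense. The adjoint is then compared with `T` on graphs, using symmetry of
`R`. -/
theorem IsBoundedInverse.isSelfAdjoint {T : H →ₗ.[ℂ] H} {R : H →L[ℂ] H} (h : IsBoundedInverse T R)
    (hR : IsSelfAdjoint R) : IsSelfAdjoint T := by
  have hsym : ∀ x y, inner ℂ (R x) y = inner ℂ x (R y) := hR.isSymmetric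
  have hd : Dense (T.domain : Set H) := by
    rw [Submodule.dense_iff_topologicalClosure_eq_top, Submodule.topologicalClosure_eq_top_iff,
      Submodule.eq_bot_iff]
    intro x hx
    rw [Submodule.mem_orthogonal] at hx
    refine h.apply_eq_zero (ext_inner_left ℂ fun y => ?_)
    rw [← hsym, inner_zero_right]
    exact hx _ (h.mem_domain_iff.2 ⟨y, rfl⟩)
  rw [LinearPMap.isSelfAdjoint_def]
  apply LinearPMap.eq_of_eq_graph
  rw [LinearPMap.adjoint_graph_eq_graph_adjoint hd]
  ext ⟨x, y⟩
  rw [Submodule.mem_adjoint_iff, h x y]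
  constructor
  · intro H1
    refine ext_inner_left ℂ fun z => ?_
    have := H1 (R z) z ((h _ _).2 rfl)
    rw [← hsym]
    exact (sub_eq_zero.1 this).symm
  · intro H1 a b hab
    rw [h a b] at hab
    simp only
    rw [← hab, ← H1, hsym, sub_self]

theorem IsBoundedInverse.mem_fracPow_domain_iff {T : H →ₗ.[ℂ] H} {R : H →L[ℂ] H}
    (h : IsBoundedInverse T R) {α : ℝ} {x : H} :
    x ∈ (fracPow T α).domain ↔ ∃ z, opPow R α z = x := by
  rw [fracPow, h.boundedInverse_eq, LinearPMap.inverse_domain]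
  exact ⟨fun ⟨z, hz⟩ => ⟨z, hz⟩, fun ⟨z, hz⟩ => ⟨⟨z, trivial⟩, hz⟩⟩

theorem IsBoundedInverse.fracPow_apply {T : H →ₗ.[ℂ] H} {R : H →L[ℂ] H}
    (h : IsBoundedInverse T R) {α : ℝ} (hinj : ∀ z, opPow R α z = 0 → z = 0)
    (x : (fracPow T α).domain) {z : H} (hz : opPow R α z = x) : fracPow T α x = z := by
  have key : ∀ (P : H →L[ℂ] H), (∀ z, P z = 0 → z = 0) →
      ∀ y : ((P : H →ₗ[ℂ] H).toPMap ⊤).inverse.domain, P z = y →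
        ((P : H →ₗ[ℂ] H).toPMap ⊤).inverse y = z := by
    intro P hP y hy
    have hker : ((P : H →ₗ[ℂ] H).toPMap ⊤).toFun.ker = ⊥ := by
      rw [LinearMap.ker_eq_bot']
      exact fun w hw => Subtype.ext (hP w hw)
    exact LinearPMap.inverse_apply_eq hker
      (x := (⟨z, trivial⟩ : ((P : H →ₗ[ℂ] H).toPMap ⊤).domain)) hy
  rw [← h.boundedInverse_eq] at hinj hz
  exact key _ hinj x hz

theorem opPow_conjStarAlgEquiv {K : Type*} [NormedAddCommGroup K] [InnerProductSpace ℂ K]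
    [CompleteSpace K] (e : H ≃ₗᵢ[ℂ] K) {a : H →L[ℂ] H} (ha : 0 ≤ a) {α : ℝ} (hα : 0 ≤ α) :
    opPow (e.conjStarAlgEquiv a) α = e.conjStarAlgEquiv (opPow a α) := by
  have hc : Continuous fun x : ℝ => x ^ α := Real.continuous_rpow_const hα
  have hcont : Continuous e.conjStarAlgEquiv := by
    refine AddMonoidHomClass.continuous_of_bound e.conjStarAlgEquiv 1 fun b => ?_
    rw [one_mul]
    refine ContinuousLinearMap.opNorm_le_bound _ (norm_nonneg _) fun x => ?_
    rw [LinearIsometryEquiv.conjStarAlgEquiv_apply_apply, LinearIsometryEquiv.norm_map]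
    exact (b.le_opNorm _).trans_eq (by rw [LinearIsometryEquiv.norm_map])
  have hpos : 0 ≤ e.conjStarAlgEquiv a := map_nonneg e.conjStarAlgEquiv ha
  unfold opPow
  rw [CFC.rpow_eq_cfc_real ha, CFC.rpow_eq_cfc_real hpos]
  exact (StarAlgHomClass.map_cfc e.conjStarAlgEquiv (fun x : ℝ => x ^ α) a hc.continuousOn hcont
    ha.isSelfAdjoint hpos.isSelfAdjoint).symm

end Inverse

/-! ### Comparison of Fourier multipliers and Sobolev spaces -/

open BoundedContinuousFunction

/-- The multiplier `(p / q) ^ α` is bounded by `C ^ α`. All changes of Sobolev weight below are of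
this form. -/
theorem exists_bcf_rpow_mul_rpow {p q : ℝ → ℝ} (hp : Continuous p) (hq : Continuous q)
    (hp0 : ∀ x, 0 < p x) (hq0 : ∀ x, 0 < q x) {C : ℝ} (hpq : ∀ x, p x ≤ C * q x)
    {α : ℝ} (hα : 0 ≤ α) :
    ∃ w : ℝ →ᵇ ℂ, ∀ x, w x = ((p x ^ α * q x ^ (-α) : ℝ) : ℂ) := by
  have hc : Continuous fun x => ((p x ^ α * q x ^ (-α) : ℝ) : ℂ) :=
    Complex.continuous_ofReal.comp ((hp.rpow_const fun x => .inl (hp0 x).ne').mul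
      (hq.rpow_const fun x => .inl (hq0 x).ne'))
  refine ⟨BoundedContinuousFunction.ofNormedAddCommGroup _ hc (C ^ α) fun x => ?_, fun _ => rfl⟩
  have h1 := (hp0 x).le
  have h2 := (hq0 x).le
  rw [Complex.norm_real, Real.norm_of_nonneg (by positivity), Real.rpow_neg h2,
    ← div_eq_mul_inv, ← Real.div_rpow h1 h2]
  exact Real.rpow_le_rpow (by positivity) ((div_le_iff₀ (hq0 x)).2 (hpq x)) hα

theorem symb_le_mul_symb {a b : ℝ} (hb : 0 < b) (ξ : ℝ) :
    symb a ξ ≤ max 1 (a / b) * symb b ξ := by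
  have h1 : a ≤ max 1 (a / b) * b := by
    rw [← div_le_iff₀ hb]; exact le_max_right _ _
  have h2 : (2 * Real.pi * ξ) ^ 2 ≤ max 1 (a / b) * (2 * Real.pi * ξ) ^ 2 :=
    le_mul_of_one_le_left (sq_nonneg _) (le_max_left _ _)
  unfold symb
  rw [mul_add]
  exact add_le_add h1 h2

theorem symb_le_mul_one_add_sq (lam ξ : ℝ) :
    symb lam ξ ≤ max lam ((2 * Real.pi) ^ 2) * (1 + ξ ^ 2) := by
  have h1 : lam ≤ max lam ((2 * Real.pi) ^ 2) := le_max_left _ _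
  have h2 : (2 * Real.pi) ^ 2 * ξ ^ 2 ≤ max lam ((2 * Real.pi) ^ 2) * ξ ^ 2 :=
    mul_le_mul_of_nonneg_right (le_max_right _ _) (sq_nonneg _)
  unfold symb
  rw [mul_pow]
  linarith

/-- The Fourier transforms of the functions in `H^s` are the functions `symb lam ^ (-s / 2) q`
with `q` in `L²`. -/
theorem memSobolev_iff {lam s : ℝ} (h : 0 < lam) (hs : 0 < s) (u : TemperedDistribution ℝ ℂ) :
    TemperedDistribution.MemSobolev s 2 u ↔
      ∃ f q : L2R, 𝓕 f = mulOp (powBcf lam (s / 2)) q ∧ (f : TemperedDistribution ℝ ℂ) = u := by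
  have hs2 : 0 ≤ s / 2 := by positivity
  have hω : Continuous fun x : ℝ => 1 + ‖x‖ ^ 2 := by fun_prop
  have hω0 : ∀ x : ℝ, 0 < 1 + ‖x‖ ^ 2 := fun x => by positivity
  -- `MemSobolev` uses the weight `1 + ξ²`, without `2π`. Here `V` and `V'` are the reciprocal
  -- multipliers exchanging it with `symb lam`, and `W` is its power `-s / 2`, of temperate growth
  -- and so able to act on distributions.
  obtain ⟨V, hV⟩ := exists_bcf_rpow_mul_rpow (continuous_symb lam) hω (symb_pos h) hω0
    (C := max lam ((2 * Real.pi) ^ 2))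
    (fun ξ => by rw [Real.norm_eq_abs, sq_abs]; exact symb_le_mul_one_add_sq lam ξ) hs2
  obtain ⟨V', hV'⟩ := exists_bcf_rpow_mul_rpow hω (continuous_symb lam) hω0 (symb_pos h)
    (C := (min lam 1)⁻¹)
    (fun ξ => by
      rw [Real.norm_eq_abs, sq_abs, ← div_eq_inv_mul, le_div_iff₀' (lt_min h one_pos)]
      exact one_add_sq_le_symb ξ) hs2
  obtain ⟨W, hW⟩ := exists_bcf_rpow_mul_rpow (p := fun _ => 1) continuous_const hω
    (fun _ => one_pos) hω0 (C := 1) (fun ξ => by simp; positivity) hs2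
  have hW1 : powBcf lam (s / 2) * V = W := by
    ext ξ
    rw [BoundedContinuousFunction.mul_apply, powBcf_apply h hs2, hV, hW, ← Complex.ofReal_mul,
      ← mul_assoc, ← Real.rpow_add (symb_pos h ξ)]
    simp
  have hW2 : W * V' = powBcf lam (s / 2) := by
    ext ξ
    rw [BoundedContinuousFunction.mul_apply, powBcf_apply h hs2, hV', hW, ← Complex.ofReal_mul,
      Real.one_rpow, one_mul, ← mul_assoc, ← Real.rpow_add (hω0 ξ)]
    simp
  have hWg : Function.HasTemperateGrowth W := by
    have : ⇑W = fun x : ℝ => ((((1 + ‖x‖ ^ 2) ^ (-s / 2) : ℝ)) : ℂ) := by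
      ext ξ
      rw [hW, Real.one_rpow, one_mul, neg_div]
    rw [this]
    fun_prop
  have hωg : Function.HasTemperateGrowth fun x : ℝ => (((1 + ‖x‖ ^ 2) ^ (s / 2) : ℝ) : ℂ) := by
    fun_prop
  have hprod : (fun x : ℝ => (((1 + ‖x‖ ^ 2) ^ (s / 2) : ℝ) : ℂ)) * ⇑W = fun _ => 1 := by
    ext ξ
    rw [Pi.mul_apply, hW, Real.one_rpow, one_mul, ← Complex.ofReal_mul, ← Real.rpow_add (hω0 ξ)]
    simp
  have hmul : ∀ q : L2R, ((mulOp W q : L2R) : TemperedDistribution ℝ ℂ) =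
      TemperedDistribution.smulLeftCLM ℂ W (q : TemperedDistribution ℝ ℂ) := fun q => by
    rw [← Lp.toTemperedDistribution_smul_eq (r := 2) hWg (W.memLp_top (μ := volume)) q]
    congr 1
    apply Lp.ext
    filter_upwards [mulOp_coeFn W q, Lp.coeFn_lpSMul (r := 2) (W.memLp_top.toLp W) q,
      (W.memLp_top (μ := volume)).coeFn_toLp] with x h1 h2 h3
    rw [h1, h2, Pi.smul_apply', h3, smul_eq_mul]
  rw [TemperedDistribution.memSobolev_iff_exists_smulLeftCLM_fourier]
  constructor
  · rintro ⟨q, hq⟩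
    refine ⟨𝓕⁻ (mulOp W q), mulOp V q, ?_, ?_⟩
    · rw [FourierTransform.fourier_fourierInv_eq, ← hW1, mulOp_mul_apply]
    · rw [← Lp.fourierInv_toTemperedDistribution_eq, hmul, ← hq,
        TemperedDistribution.smulLeftCLM_smulLeftCLM_apply hωg hWg, hprod,
        TemperedDistribution.smulLeftCLM_const, one_smul, FourierTransform.fourierInv_fourier_eq]
  · rintro ⟨f, q, hf, rfl⟩
    refine ⟨mulOp V' q, ?_⟩
    rw [Lp.fourier_toTemperedDistribution_eq, hf, ← hW2, mulOp_mul_apply, hmul,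
      TemperedDistribution.smulLeftCLM_smulLeftCLM_apply hWg hωg, mul_comm ⇑W, hprod,
      TemperedDistribution.smulLeftCLM_const, one_smul]

/-- The Sobolev norm in terms of the representation `𝓕 f = symb lam ^ (-s / 2) q`. -/
theorem exists_sobolevNorm_eq {lam s : ℝ} (h : 0 < lam) (hs : 0 < s) : ∃ V V' : ℝ →ᵇ ℂ,
    V' * V = 1 ∧ ∀ f q : L2R, 𝓕 f = mulOp (powBcf lam (s / 2)) q →
      sobolevNorm s f = ‖mulOp V q‖ := by
  have hs2 : 0 ≤ s / 2 := by positivity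
  -- The weight in `sobolevNorm` is `symb 1`, so `V` is `(symb 1 / symb lam) ^ (s / 2)` and `V'` its
  -- reciprocal.
  obtain ⟨V, hV⟩ := exists_bcf_rpow_mul_rpow (continuous_symb 1) (continuous_symb lam)
    (symb_pos one_pos) (symb_pos h) (symb_le_mul_symb h) hs2
  obtain ⟨V', hV'⟩ := exists_bcf_rpow_mul_rpow (continuous_symb lam) (continuous_symb 1)
    (symb_pos h) (symb_pos one_pos) (symb_le_mul_symb one_pos) hs2
  refine ⟨V, V', ?_, fun f q hf => ?_⟩
  · ext ξ
    have h1 := symb_pos h ξ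
    have h2 := symb_pos one_pos ξ
    rw [BoundedContinuousFunction.mul_apply, hV, hV', ← Complex.ofReal_mul,
      BoundedContinuousFunction.coe_one, Pi.one_apply, Complex.ofReal_eq_one,
      Real.rpow_neg h1.le, Real.rpow_neg h2.le]
    field_simp
  · rw [sobolevNorm, Lp.norm_def]
    congr 1
    refine eLpNorm_congr_ae ?_
    filter_upwards [mulOp_coeFn V q, mulOp_coeFn (powBcf lam (s / 2)) q] with ξ h1 h2
    rw [sobolevWeighted, hf, h1, h2, hV, powBcf_apply h hs2, Complex.real_smul, ← mul_assoc,
      ← Complex.ofReal_mul]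
    rfl

end DeltaPotential

namespace DeltaPotential

/-! ### The resolvent of `-Δ_γ` -/

theorem mem_negDeltaAdd_graph_iff {γ lam : ℝ} {x y : L2R} :
    (x, y) ∈ (negDeltaAdd γ lam).graph ↔ IsDeltaLaplacian γ x (y - (lam : ℂ) • x) := by
  have h : ∀ u, (x, u) ∈ (negDelta γ).graph ↔ IsDeltaLaplacian γ x u := fun u => by
    rw [negDelta_graph]; rfl
  rw [← h, LinearPMap.mem_graph_iff, LinearPMap.mem_graph_iff]
  have e : ∀ z : (negDelta γ).domain,
      negDeltaAdd γ lam z = (lam : ℂ) • (z : L2R) + negDelta γ z := fun _ => rfl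
  refine exists_congr fun (z : (negDelta γ).domain) => and_congr_right fun hz => ?_
  simp only at hz ⊢
  rw [← hz, eq_sub_iff_add_eq']
  exact Iff.of_eq (congrArg (· = y) (e z))

theorem isBoundedInverse_negDeltaAdd {γ lam : ℝ} (h : 0 < lam) (hγ : γ < 2 * √lam) :
    IsBoundedInverse (negDeltaAdd γ lam)
      ((Lp.fourierTransformₗᵢ ℝ ℂ).symm.conjStarAlgEquiv (fourierRes γ lam)) := by
  intro x y
  rw [mem_negDeltaAdd_graph_iff, isDeltaLaplacian_iff h hγ, sub_add_cancel,
    LinearIsometryEquiv.conjStarAlgEquiv_apply_apply, LinearIsometryEquiv.symm_symm]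
  exact eq_comm.trans (LinearIsometryEquiv.symm_apply_eq _).symm

/-- Injectivity comes from being the inverse of an operator: a kernel vector would be a value of
`-Δ_γ + lam` at `0`. -/
theorem fourierRes_apply_eq_zero {γ lam : ℝ} (h : 0 < lam) (hγ : γ < 2 * √lam) {y : L2R}
    (hy : fourierRes γ lam y = 0) : y = 0 := by
  obtain ⟨z, rfl⟩ := (Lp.fourierTransformₗᵢ ℝ ℂ).surjective y
  have hz : z = 0 := (isBoundedInverse_negDeltaAdd h hγ).apply_eq_zero (by
    rw [LinearIsometryEquiv.conjStarAlgEquiv_apply_apply, LinearIsometryEquiv.symm_symm, hy,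
      map_zero])
  rw [hz, map_zero]

/-- The resolvent identity. -/
theorem fourierRes_resolvent {γ lam : ℝ} (h : 0 < lam) (hγ : γ < 2 * √lam) {t : ℝ} (ht : 0 < t) :
    fourierRes γ (lam + t) * (1 + t • fourierRes γ lam) = fourierRes γ lam := by
  have hle : √lam ≤ √(lam + t) := Real.sqrt_le_sqrt (by linarith)
  ext1 y
  change fourierRes γ (lam + t) (y + t • fourierRes γ lam y) = fourierRes γ lam y
  obtain ⟨f, hf⟩ : ∃ f : L2R, 𝓕 f = fourierRes γ lam y :=
    ⟨𝓕⁻ (fourierRes γ lam y), FourierTransform.fourier_fourierInv_eq _⟩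
  obtain ⟨z, hz⟩ : ∃ z : L2R, 𝓕 z = y := ⟨𝓕⁻ y, FourierTransform.fourier_fourierInv_eq y⟩
  -- Membership in the graph of `-Δ_γ` does not involve `lam`, so it can be written with `lam` and
  -- read back with `lam + t`.
  have h1 : IsDeltaLaplacian γ f (z - (lam : ℂ) • f) := by
    rw [isDeltaLaplacian_iff h hγ, sub_add_cancel, hz, hf]
  rw [isDeltaLaplacian_iff (by linarith : 0 < lam + t) (by linarith)] at h1
  have h2 : (z - (lam : ℂ) • f + ((lam + t : ℝ) : ℂ) • f : L2R) = z + (t : ℂ) • f := by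
    push_cast
    module
  rw [h2, FourierTransform.fourier_add, FourierTransform.fourier_smul, hz, hf] at h1
  exact h1.symm

/-- The functions in the domain of `(-Δ_γ + lam) ^ α` in Fourier variables. -/
theorem exists_equiv_fracPow {γ lam : ℝ} (h : 0 < lam) (hγ : γ < 2 * √lam) {α : ℝ} (h0 : 0 < α)
    (hα : α < 3 / 4) : ∃ A : L2R ≃L[ℂ] L2R,
      (∀ f : L2R, f ∈ (fracPow (negDeltaAdd γ lam) α).domain ↔
        ∃ q : L2R, 𝓕 f = mulOp (powBcf lam α) (A (𝓕 q))) ∧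
      ∀ (f : (fracPow (negDeltaAdd γ lam) α).domain) (q : L2R),
        𝓕 (f : L2R) = mulOp (powBcf lam α) (A (𝓕 q)) → fracPow (negDeltaAdd γ lam) α f = q := by
  have hinj : ∀ y, fourierRes γ lam y = 0 → y = 0 := fun y => fourierRes_apply_eq_zero h hγ
  obtain ⟨A, hA⟩ := exists_equiv_fourierRes_rpow h hγ hinj
    (fun t ht => fourierRes_resolvent h hγ ht) h0 hα
  have hpos := fourierRes_nonneg h hγ
  have hR := isBoundedInverse_negDeltaAdd h hγ
  set e := (Lp.fourierTransformₗᵢ ℝ ℂ).symm with he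
  have hp : ∀ q x : L2R, opPow (e.conjStarAlgEquiv (fourierRes γ lam)) α q = x ↔
      𝓕 x = mulOp (powBcf lam α) (A (𝓕 q)) := fun q x => by
    rw [opPow_conjStarAlgEquiv e hpos h0.le, hA, LinearIsometryEquiv.conjStarAlgEquiv_apply_apply,
      LinearIsometryEquiv.symm_apply_eq]
    exact eq_comm
  refine ⟨A, fun f => ?_, fun f q hq => ?_⟩
  · rw [hR.mem_fracPow_domain_iff]
    exact exists_congr fun q => hp q f
  · refine hR.fracPow_apply (fun z hz => ?_) f ((hp q f).2 hq)
    exact rpow_apply_eq_zero (map_nonneg e.conjStarAlgEquiv hpos) (fun y => hR.apply_eq_zero)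
      ⟨h0, by linarith⟩ z hz

end DeltaPotential

/-! ### The theorem -/

theorem theoremC1 (γ lam s : ℝ) (hγ : γ ≠ 0)
    (hneg : γ < 0 → 0 < lam) (hpos : 0 < γ → γ ^ 2 / 4 < lam)
    (hs : 0 < s) (hs' : s < 3 / 2) :
    -- the operator is self-adjoint with a bounded nonnegative inverse
    (IsSelfAdjoint (DeltaPotential.negDeltaAdd γ lam) ∧
      ∃ R : DeltaPotential.L2R →L[ℂ] DeltaPotential.L2R,
        DeltaPotential.IsBoundedInverse (DeltaPotential.negDeltaAdd γ lam) R ∧ 0 ≤ R) ∧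
    -- the domain of its power is the Sobolev space, as subspaces of the tempered distributions
    (∀ u : TemperedDistribution ℝ ℂ,
      TemperedDistribution.MemSobolev s 2 u ↔
        ∃ f ∈ (DeltaPotential.fracPow (DeltaPotential.negDeltaAdd γ lam) (s / 2)).domain,
          (f : TemperedDistribution ℝ ℂ) = u) ∧
    -- the norms are equivalent
    (∃ c C : ℝ, 0 < c ∧ 0 < C ∧
      ∀ f : (DeltaPotential.fracPow (DeltaPotential.negDeltaAdd γ lam) (s / 2)).domain,
        c * DeltaPotential.sobolevNorm s (f : DeltaPotential.L2R) ≤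
            ‖DeltaPotential.fracPow (DeltaPotential.negDeltaAdd γ lam) (s / 2) f‖ ∧
          ‖DeltaPotential.fracPow (DeltaPotential.negDeltaAdd γ lam) (s / 2) f‖ ≤
            C * DeltaPotential.sobolevNorm s (f : DeltaPotential.L2R)) := by
  have h : 0 < lam := by
    rcases lt_or_gt_of_ne hγ with h | h
    · exact hneg h
    · exact (by positivity : 0 ≤ γ ^ 2 / 4).trans_lt (hpos h)
  -- Both cases of the hypothesis on `lam` enter only through this inequality and `0 < lam`.
  have hγ2 : γ < 2 * √lam := by
    rcases lt_or_gt_of_ne hγ with h1 | h1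
    · exact h1.trans_le (by positivity)
    · have := Real.lt_sqrt_of_sq_lt (show (γ / 2) ^ 2 < lam by linarith [hpos h1])
      linarith
  have hR := DeltaPotential.isBoundedInverse_negDeltaAdd h hγ2
  have hR0 := map_nonneg (Lp.fourierTransformₗᵢ ℝ ℂ).symm.conjStarAlgEquiv
    (DeltaPotential.fourierRes_nonneg h hγ2)
  obtain ⟨A, hA, hA'⟩ := DeltaPotential.exists_equiv_fracPow h hγ2 (α := s / 2) (by linarith)
    (by linarith)
  refine ⟨⟨hR.isSelfAdjoint hR0.isSelfAdjoint, _, hR, hR0⟩, fun u => ?_, ?_⟩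
  · rw [DeltaPotential.memSobolev_iff h hs]
    constructor
    · rintro ⟨f, q, hf, hu⟩
      refine ⟨f, (hA f).2 ⟨𝓕⁻ (A.symm q), ?_⟩, hu⟩
      rw [FourierTransform.fourier_fourierInv_eq, A.apply_symm_apply, hf]
    · rintro ⟨f, hf, hu⟩
      obtain ⟨q, hq⟩ := (hA f).1 hf
      exact ⟨f, _, hq, hu⟩
  · obtain ⟨V, V', hV, hnorm⟩ := DeltaPotential.exists_sobolevNorm_eq h hs
    set B := DeltaPotential.mulOp V ∘L (A : DeltaPotential.L2R →L[ℂ] DeltaPotential.L2R)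
    set B' := (A.symm : DeltaPotential.L2R →L[ℂ] DeltaPotential.L2R) ∘L DeltaPotential.mulOp V'
    -- The Sobolev norm of `f` is `‖B (𝓕 q)‖`, where `q` is the value of the power at `f`, and `B'`
    -- is a left inverse of `B`. Adding `1` keeps the constants positive and nonzero.
    refine ⟨(‖B‖ + 1)⁻¹, ‖B'‖ + 1, by positivity, by positivity, fun f => ?_⟩
    obtain ⟨q, hq⟩ := (hA f).1 f.2
    have e1 : DeltaPotential.sobolevNorm s (f : DeltaPotential.L2R) = ‖B (𝓕 q)‖ := hnorm _ _ hq
    have e2 : B' (B (𝓕 q)) = 𝓕 q := by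
      change A.symm (DeltaPotential.mulOp V' (DeltaPotential.mulOp V (A (𝓕 q)))) = 𝓕 q
      rw [← DeltaPotential.mulOp_mul_apply, hV, DeltaPotential.mulOp_one_apply,
        A.symm_apply_apply]
    rw [hA' f q hq, e1, ← Lp.norm_fourier_eq q]
    constructor
    · rw [inv_mul_le_iff₀ (by positivity)]
      exact (B.le_opNorm _).trans (by gcongr; linarith)
    · conv_lhs => rw [← e2]
      exact (B'.le_opNorm _).trans (by gcongr; linarith)
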